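/- **Notation.** Let $h=h(n)=2^{-n}$, $n\in\mathbb N$, and let $G_n=h\mathbb Z^d$ be the grid of knots $h\mathbf k$, $\mathbf k\in\mathbb Z^d$. Let $\chi(t)=\max(0,1-|t|)$. For $\mathbf r\in\mathbb N^d$ with all $r_i\ge1$ and $\boldsymbol\rho\in\mathbb Z^d$ put $I(R)=\{\boldsymbol\rho+(r_1m_1,\dots,r_dm_d):\mathbf m\in\mathbb Z^d\}$ and $vol(R)=\prod_i r_i$, and let $E_n(R,\mathbb R^d)$ be the space of functions $\sum_{\mathbf k\in I(R)}u_{\mathbf k}\psi_{\mathbf k}$ with real coefficients, where $\psi_{\mathbf k}(\mathbf x)=\prod_i\chi\big((x_i-hk_i)/(hr_i)\big)$. For $\boldsymbol\rho=0$ and $r_1=\dots=r_d=1$ it is denoted $E_n=E_n(\mathbb R^d)$. The column of coefficients of $u(n)\in E_n$ is $\mathbf u_n$. For a grid-function $u$ and an integer $s\neq0$ put $D_i(sh)u(\mathbf x)=\frac1{sh}\big(u(\mathbf x+sh\mathbf e_i)-u(\mathbf x)\big)$, $\mathbf x\in G_n$; write $\langle\mathbf v|\mathbf w\rangle=\sum_{\mathbf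 k}v_{\mathbf k}w_{\mathbf k}$. **The form and its discretization.** Let $d\ge2$ and let $a_{ij},b_i,c$ $(1\le i,j\le d)$ be real, bounded and uniformly continuous functions on $\mathbb R^d$. For $v,u\in W_2^1(\mathbb R^d)$ let $$a(v,u)=\sum_{i,j}\int a_{ij}\,\partial_iv\,\partial_ju\,d\mathbf x-\sum_i\int b_i\,\partial_iv\;u\,d\mathbf x+\int c\,v\,u\,d\mathbf x .$$ For each pair $i<j$ there is given a rule that assigns to $\mathbf x\in\mathbb R^d$ a sign $\varepsilon=\varepsilon^{ij}(\mathbf x)\in\{1,-1\}$ ($\varepsilon=1$: the first extended scheme, intended for $a_{ij}\le0$; $\varepsilon=-1$: the second one, intended for $a_{ij}\ge0$) and positive integers $r=r^{ij}(\mathbf x)$, $s=s^{ij}(\mathbf x)$. The rule takes finitely many values, and each value is taken on a set whose boundary has Lebesgue measure zero (for instance, the rule is constant). With $\mathbf y=\mathbf x+\frac h2(\mathbf e_i+\varepsilon\mathbf e_j)$ and $\mathbf y'=\mathbf x+\frac h2(r\mathbf e_i+\varepsilon s\mathbf e_j)$ put, for $\mathbf x\in G_n$, $$\begin{aligned}a_n^{ij}(v,u;\mathbf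 x)=\;&\tfrac1{d-1}\big[a_{ii}(\mathbf y)D_i(h)v\,D_i(h)u+a_{jj}(\mathbf y)D_j(\varepsilon h)v\,D_j(\varepsilon h)u\big]\\&+a_{ij}(\mathbf y')D_i(rh)v\,D_j(\varepsilon sh)u+a_{ji}(\mathbf y')D_j(\varepsilon sh)v\,D_i(rh)u\\&+\varepsilon a_{ij}(\mathbf y')\tfrac rs\big[D_i(h)v\,D_i(h)u-D_i(rh)v\,D_i(rh)u\big]\\&+\varepsilon a_{ji}(\mathbf y')\tfrac sr\big[D_j(\varepsilon h)v\,D_j(\varepsilon h)u-D_j(\varepsilon sh)v\,D_j(\varepsilon sh)u\big],\end{aligned}$$ all differences being taken at $\mathbf x$. Let $A_n$ be the matrix on $G_n$ of the bilinear form $$a_n(v,u)=\sum_{\mathbf x\in G_n}\Big\{\sum_{i<j}a_n^{ij}(v,u;\mathbf x)-\sum_iD_i(h)v(\mathbf x)\big[b_i^+(\mathbf x+\tfrac h2\mathbf e_i)u(\mathbf x)-b_i^-(\mathbf x+\tfrac h2\mathbf e_i)u(\mathbf x+h\mathbf e_i)\big]+c(\mathbf x)v(\mathbf x)u(\mathbf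 x)\Big\},$$ that is, $(A_n)_{\mathbf k\mathbf l}=a_n(\boldsymbol\delta_{\mathbf k},\boldsymbol\delta_{\mathbf l})$ for the coordinate columns $\boldsymbol\delta_{\mathbf k}$; here $b^\pm=\max(\pm b,0)$. **Proposition (Consistency).** (i) Let $v(n),u(n)\in E_n(\mathbb R^d)\cap W_2^1(\mathbb R^d)$, $n\in\mathbb N$, where $v(n)\to v$ weakly and $u(n)\to u$ strongly in $W_2^1(\mathbb R^d)$. Then the series $\langle\mathbf v_n|A_n\mathbf u_n\rangle$ converge absolutely and $$\lim_n\,h^d\,\langle\mathbf v_n\,|\,A_n\mathbf u_n\rangle=a(v,u).$$ (ii) Let $d\ge1$, let $p$ be bounded and uniformly continuous on $\mathbb R^d$, $i,j\in\{1,\dots,d\}$, let $\mathbf r$ be fixed and let $\boldsymbol\rho=\boldsymbol\rho(n)$ be arbitrary, and let $\mathbf x(n,\cdot):\mathbb R^d\to\mathbb R^d$ satisfy $|\mathbf x(n,h\mathbf k)-h\mathbf k|\le\omega n^{-1}$ for all $n\ge1$, $\mathbf k\in I(R)$, with a constant $\omega$. If $v(n),u(n)\in E_n(R,\mathbb R^d)\cap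 W_2^1(\mathbb R^d)$ and $v(n)\to v$ weakly, $u(n)\to u$ strongly in $W_2^1(\mathbb R^d)$, then the following series converge absolutely and $$\lim_n\;h^d\,vol(R)\sum_{\mathbf k\in I(R)}p(\mathbf x(n,h\mathbf k))\,D_i(r_ih)v(n)(h\mathbf k)\,D_j(r_jh)u(n)(h\mathbf k)=\int_{\mathbb R^d}p\,\partial_iv\,\partial_ju\,d\mathbf x .$$ -/

import Mathlib

open MeasureTheory Filter Topology

noncomputable section

namespace DivScheme

/-- Points of `ℝ^d`, with Lebesgue measure `volume`. -/
abbrev Pt (d : ℕ) : Type := Fin d → ℝ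

/-- Multi-indices of grid-knots. -/
abbrev Idx (d : ℕ) : Type := Fin d → ℤ

/-! ### The Hilbert space `W_2^1(ℝ^d)` -/

/-- Classical partial derivative (used only for test functions). -/
def partialDeriv {d : ℕ} (i : Fin d) (φ : Pt d → ℝ) (x : Pt d) : ℝ :=
  fderiv ℝ φ x (Pi.single i 1)

/-- Smooth compactly supported test functions. -/
def IsTest {d : ℕ} (φ : Pt d → ℝ) : Prop :=
  ContDiff ℝ (⊤ : ℕ∞) φ ∧ HasCompactSupport φ

theorem IsTest.memLp {d : ℕ} {φ : Pt d → ℝ} (h : IsTest φ) :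
    MemLp φ 2 (volume : Measure (Pt d)) :=
  h.1.continuous.memLp_of_hasCompactSupport h.2

theorem IsTest.partialDeriv_memLp {d : ℕ} {φ : Pt d → ℝ} (h : IsTest φ) (i : Fin d) :
    MemLp (partialDeriv i φ) 2 (volume : Measure (Pt d)) := by
  refine Continuous.memLp_of_hasCompactSupport ?_ ?_
  · exact (h.1.continuous_fderiv (by simp)).clm_apply continuous_const
  · exact h.2.fderiv_apply ℝ (Pi.single i 1)

/-- The ambient Hilbert space `L_2 × (L_2)^d`: the component `none` is a function, the component
`some i` is its candidate `i`-th weak partial derivative. -/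
abbrev L2Tuple (d : ℕ) : Type :=
  PiLp 2 (fun _ : Option (Fin d) => Lp ℝ 2 (volume : Measure (Pt d)))

/-- The Sobolev space `W_2^1(ℝ^d)`: an `L_2` function together with its (unique) weak gradient
in `L_2`, with the inner product `(u | w) + ∑ i, (∂_i u | ∂_i w)` inherited from `L2Tuple`. -/
def W12 (d : ℕ) : Submodule ℝ (L2Tuple d) where
  carrier := {F | ∀ (i : Fin d) (φ : Pt d → ℝ), IsTest φ →
    ∫ x, F none x * partialDeriv i φ x = -∫ x, F (some i) x * φ x}
  zero_mem' := by
    intro i φ _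
    have h0 : ∀ (o : Option (Fin d)) (ψ : Pt d → ℝ),
        ∫ x, (0 : L2Tuple d) o x * ψ x = 0 := by
      intro o ψ
      rw [← integral_zero (Pt d) ℝ]
      refine integral_congr_ae ?_
      filter_upwards [Lp.coeFn_zero ℝ 2 (volume : Measure (Pt d))] with x hx
      rw [PiLp.zero_apply, hx]
      simp
    rw [h0, h0, neg_zero]
  add_mem' := by
    intro F G hF hG i φ hφ
    have hadd : ∀ (o : Option (Fin d)) (ψ : Pt d → ℝ), MemLp ψ 2 (volume : Measure (Pt d)) →
        ∫ x, (F + G) o x * ψ x = (∫ x, F o x * ψ x) + ∫ x, G o x * ψ x := by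
      intro o ψ hψ
      have hF' : Integrable (fun x => F o x * ψ x) := (Lp.memLp (F o)).integrable_mul hψ
      have hG' : Integrable (fun x => G o x * ψ x) := (Lp.memLp (G o)).integrable_mul hψ
      rw [← integral_add hF' hG']
      refine integral_congr_ae ?_
      filter_upwards [Lp.coeFn_add (F o) (G o)] with x hx
      rw [PiLp.add_apply, hx]
      simp [add_mul]
    rw [hadd _ _ (hφ.partialDeriv_memLp i), hadd _ _ hφ.memLp, hF i φ hφ, hG i φ hφ, neg_add]
  smul_mem' := by
    intro c F hF i φ hφ
    have hsmul : ∀ (o : Option (Fin d)) (ψ : Pt d → ℝ),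
        ∫ x, (c • F) o x * ψ x = c * ∫ x, F o x * ψ x := by
      intro o ψ
      rw [← integral_const_mul]
      refine integral_congr_ae ?_
      filter_upwards [Lp.coeFn_smul c (F o)] with x hx
      rw [PiLp.smul_apply, hx]
      simp [mul_assoc]
    rw [hsmul, hsmul, hF i φ hφ, mul_neg]

/-- The function underlying an element of `W_2^1`. -/
def W12fn {d : ℕ} (u : W12 d) : Pt d → ℝ := (u : L2Tuple d) none

/-- The `i`-th weak partial derivative of an element of `W_2^1`. -/
def W12grad {d : ℕ} (u : W12 d) (i : Fin d) : Pt d → ℝ := (u : L2Tuple d) (some i)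

/-- Weak convergence in the normed space `W_2^1`. -/
def WeaklyConverges {d : ℕ} (v : ℕ → W12 d) (v' : W12 d) : Prop :=
  Tendsto (fun n => toWeakSpace ℝ (W12 d) (v n)) atTop (𝓝 (toWeakSpace ℝ (W12 d) v'))

/-! ### The bilinear form -/

/-- `a(v,u) = ∑ ∫ a_ij ∂_i v ∂_j u - ∑ ∫ b_i ∂_i v u + ∫ c v u`. -/
def ellipticForm {d : ℕ} (a : Fin d → Fin d → Pt d → ℝ) (b : Fin d → Pt d → ℝ)
    (c : Pt d → ℝ) (v u : W12 d) : ℝ :=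
  (∑ i, ∑ j, ∫ x, a i j x * W12grad v i x * W12grad u j x)
    - (∑ i, ∫ x, b i x * W12grad v i x * W12fn u x)
    + ∫ x, c x * W12fn v x * W12fn u x

/-- Bounded and uniformly continuous functions on `ℝ^d`. -/
def BddUnifCont {d : ℕ} (p : Pt d → ℝ) : Prop :=
  UniformContinuous p ∧ ∃ C : ℝ, ∀ x, |p x| ≤ C

/-! ### Grids and hat functions -/

/-- The grid-step `h(n) = 2^{-n}`. -/
def step (n : ℕ) : ℝ := (2 : ℝ)⁻¹ ^ n

/-- The grid-knot `h k`. -/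
def knot {d : ℕ} (n : ℕ) (k : Idx d) : Pt d := fun l => step n * k l

/-- The canonical hat function on `ℝ`, with support `[-1,1]`. -/
def hat (t : ℝ) : ℝ := max 0 (1 - |t|)

/-- The hat function centred at the knot `h k`, with support `∏ [h k_i - r_i h, h k_i + r_i h]`. -/
def hatFn {d : ℕ} (n : ℕ) (r : Fin d → ℕ) (k : Idx d) (z : Pt d) : ℝ :=
  ∏ i, hat ((z i - step n * k i) / (step n * r i))

/-- The multi-indices of the subgrid with origin `ρ` and periods `r` are `ρ + (r_1 j_1, …)`,
`j ∈ ℤ^d`. -/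
def subIdx {d : ℕ} (ρ : Idx d) (r : Fin d → ℕ) (j : Idx d) : Idx d :=
  fun i => ρ i + r i * j i

/-- The imbedding of a grid-function on the subgrid `(ρ, r)` into the hat-function space: the sum
of the `u_k ψ_k` over the indices `k` of the subgrid (locally finite). -/
def interp {d : ℕ} (n : ℕ) (ρ : Idx d) (r : Fin d → ℕ) (u : Idx d → ℝ) (z : Pt d) : ℝ :=
  ∑' j : Idx d, u (subIdx ρ r j) * hatFn n r (subIdx ρ r j) z

/-- The imbedding for the full grid `G_n` (origin `0`, all periods `1`). -/
def interpFull {d : ℕ} (n : ℕ) (u : Idx d → ℝ) : Pt d → ℝ :=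
  interp n (fun _ => 0) (fun _ => 1) u

/-- The difference quotient with signed step `s h` in direction `i`, at the knot `h k`. -/
def diffQ {d : ℕ} (n : ℕ) (i : Fin d) (s : ℤ) (u : Idx d → ℝ) (k : Idx d) : ℝ :=
  (u (k + Pi.single i s) - u k) / (s * step n)

/-! ### Extended schemes -/

/-- The data of a two-dimensional extended scheme at a knot: which of the two schemes is used
(the first one, made for `a_12 ≤ 0`, or the second one, made for `a_12 ≥ 0`), and the
parameters `r = (r_1, r_2)`. -/
structure Stencil where
  second : Bool
  r₁ : ℕ
  r₂ : ℕ
  pos₁ : 0 < r₁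
  pos₂ : 0 < r₂

/-- `1` for the first scheme, `-1` for the second: the orientation of the second direction. -/
def Stencil.ε (t : Stencil) : ℤ := if t.second then -1 else 1

/-- The sampling point `x + (h/2) (p e_i + q e_j)` at the knot `x = h k`. -/
def samplePt {d : ℕ} (n : ℕ) (i j : Fin d) (p q : ℤ) (k : Idx d) : Pt d :=
  knot n k + (step n / 2) • (Pi.single i (p : ℝ) + Pi.single j (q : ℝ))

/-- The summand, at the knot `h k`, of the discrete form of the extended scheme in the plane of
the directions `i < j`, with the diagonal coefficients divided by `d - 1`. -/
def planeTerm {d : ℕ} (a : Fin d → Fin d → Pt d → ℝ) (n : ℕ) (i j : Fin d) (t : Stencil)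
    (v u : Idx d → ℝ) (k : Idx d) : ℝ :=
  let ε := t.ε
  let y := samplePt n i j 1 ε k
  let yr := samplePt n i j t.r₁ (ε * t.r₂) k
  let Di := fun w : Idx d → ℝ => diffQ n i 1 w k
  let Dj := fun w : Idx d → ℝ => diffQ n j ε w k
  let Dir := fun w : Idx d → ℝ => diffQ n i t.r₁ w k
  let Djr := fun w : Idx d → ℝ => diffQ n j (ε * t.r₂) w k
  (a i i y / ((d : ℝ) - 1) * Di v * Di u + a j j y / ((d : ℝ) - 1) * Dj v * Dj u)
    + (a i j yr * Dir v * Djr u + a j i yr * Djr v * Dir u)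
    + (ε * a i j yr * ((t.r₁ : ℝ) / t.r₂) * (Di v * Di u - Dir v * Dir u)
      + ε * a j i yr * ((t.r₂ : ℝ) / t.r₁) * (Dj v * Dj u - Djr v * Djr u))

/-- The summand at the knot `h k` of the upwind discretization of `-∑ ∫ b_i ∂_i v u`:
the value of `u` is taken at the upstream end of the edge from `h k` to `h k + h e_i`,
according to the sign of `b_i` at its midpoint. -/
def upwindTerm {d : ℕ} (b : Fin d → Pt d → ℝ) (n : ℕ) (v u : Idx d → ℝ) (k : Idx d) : ℝ :=
  -∑ i, diffQ n i 1 v k *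
    (max (b i (knot n k + (step n / 2) • Pi.single i (1 : ℝ))) 0 * u k
      - max (-b i (knot n k + (step n / 2) • Pi.single i (1 : ℝ))) 0 * u (k + Pi.single i 1))

/-- The discrete form `a_n(v,u)`: the sum over all knots of the extended-scheme summands for all
planes `i < j`, the upwind summand and the zero-order summand.  `S i j x` is the stencil used in
the plane `i < j` at the knot `x`. -/
def discreteForm {d : ℕ} (a : Fin d → Fin d → Pt d → ℝ) (b : Fin d → Pt d → ℝ)
    (c : Pt d → ℝ) (S : Fin d → Fin d → Pt d → Stencil) (n : ℕ) (v u : Idx d → ℝ) : ℝ :=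
  ∑' k : Idx d,
    ((∑ i, ∑ j, if i < j then planeTerm a n i j (S i j (knot n k)) v u k else 0)
      + upwindTerm b n v u k + c (knot n k) * v k * u k)

/-- The system matrix `A_n` of the discrete form: its entries are the values of the form at
pairs of coordinate columns. -/
def systemMatrix {d : ℕ} (a : Fin d → Fin d → Pt d → ℝ) (b : Fin d → Pt d → ℝ)
    (c : Pt d → ℝ) (S : Fin d → Fin d → Pt d → Stencil) (n : ℕ) :
    Matrix (Idx d) (Idx d) ℝ :=
  fun k l => discreteForm a b c S n (Pi.single k 1) (Pi.single l 1)

/-- The column `A u` for an infinite matrix `A` with finite rows. -/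
def applyMatrix {d : ℕ} (A : Matrix (Idx d) (Idx d) ℝ) (u : Idx d → ℝ) (k : Idx d) : ℝ :=
  ∑' l : Idx d, A k l * u l

/-- An admissible choice of stencils: finitely many stencils occur, and each is used on a region
with boundary of measure zero. -/
def AdmissibleStencils {d : ℕ} (S : Fin d → Fin d → Pt d → Stencil) : Prop :=
  ∀ i j, i < j → (Set.range (S i j)).Finite ∧
    ∀ t : Stencil, volume (frontier (S i j ⁻¹' {t})) = 0

/-! ### Riemann-sum functionals -/

/-- The summand of `F_n(v,u)` at the knot `h k`. -/
def riemannTerm {d : ℕ} (p : Pt d → ℝ) (ξ : ℕ → Pt d → Pt d) (r : Fin d → ℕ) (i j : Fin d)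
    (n : ℕ) (v u : Idx d → ℝ) (k : Idx d) : ℝ :=
  p (ξ n (knot n k)) * diffQ n i (r i) v k * diffQ n j (r j) u k

end DivScheme

end

open DivScheme

noncomputable section

namespace DivScheme

/-! Both statements reduce to a weak-strong pairing in `L_2`: if `f n` converges weakly and `g n`
strongly, then the inner products converge (`WeakTo.tendsto_inner`). Three bridges lead from grid
sums to such a pairing.

From differences to derivatives: a translation difference of a `W_2^1`-function is the step times
the average of the translates of its weak derivative along the segment
(`translate_sub_eq_segmentAverage`). These averages are contractions that tend strongly to the
identity, and the adjoint of one is the average over the opposite segment. So difference quotients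
inherit weak and strong convergence, with the derivative as limit. Translation along a grid maps
hat-function sums to hat-function sums, so such a quotient is again a hat-function sum, with the
discrete quotients as coefficients (`diffL2_hatSum`).

From sums to integrals: a grid sum times the cell volume is the integral of a function constant on
cells (`grid_sum_eq_integral`). Absolute convergence is obtained from its integrability.

From hat functions to step functions: the norm of a step function is at most `2 ^ d` times that of
the hat-function sum with the same coefficients (`exists_stepFn_Lp`). Conversely, the hat-function
sum is a combination of small translates of the step function, with periodic weights that sum to
one. Duality against a fixed function carries over weak convergence (`weakTo_stepFn`); density of
test functions carries over strong convergence (`tendsto_stepFn`). Bounded coefficients that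
converge almost everywhere are absorbed in the strong factor (`tendsto_grid_sum`), which yields the
Riemann sums directly.

For the scheme, the knots are divided by stencil, so that all difference steps become constants.
Each summand then has its own limit: the correction terms cancel in pairs, the upwind parts
recombine to `b`, and each diagonal coefficient is collected from `d - 1` planes. The matrix enters
through finite combinations of shifts, for which rearranging the series on square-summable columns
is harmless. -/

/-! ### Weak and strong convergence in `L_2` -/

/-- The space `L_2(ℝ^d)`. -/
abbrev L2 (d : ℕ) : Type := Lp ℝ 2 (volume : Measure (Pt d))

/-- Weak convergence of a sequence in an inner product space, tested by inner products. -/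
def WeakTo {E : Type*} [NormedAddCommGroup E] [InnerProductSpace ℝ E] (f : ℕ → E) (g : E) : Prop :=
  ∀ φ : E, Tendsto (fun n => inner ℝ φ (f n)) atTop (𝓝 (inner ℝ φ g))

section Hilbert

variable {E : Type*} [NormedAddCommGroup E] [InnerProductSpace ℝ E]

/-- Uniform boundedness principle: each functional `inner (f n)` converges pointwise, hence is
pointwise bounded. -/
theorem WeakTo.bounded [CompleteSpace E] {f : ℕ → E} {g : E} (h : WeakTo f g) :
    ∃ C, 0 ≤ C ∧ ∀ n, ‖f n‖ ≤ C := by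
  obtain ⟨C, hC⟩ := banach_steinhaus (g := fun n => innerSL ℝ (f n)) (fun φ => by
    obtain ⟨B, hB⟩ := (h φ).norm.bddAbove_range
    refine ⟨B, fun n => ?_⟩
    have := hB ⟨n, rfl⟩
    simpa only [innerSL_apply_apply, real_inner_comm] using this)
  refine ⟨C, (norm_nonneg _).trans (hC 0), fun n => ?_⟩
  simpa using hC n

theorem tendsto_inner_of_bounded_of_tendsto {f g : ℕ → E} {C : ℝ} (hf : ∀ n, ‖f n‖ ≤ C)
    (hg : Tendsto g atTop (𝓝 0)) : Tendsto (fun n => inner ℝ (f n) (g n)) atTop (𝓝 0) := by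
  refine squeeze_zero_norm (a := fun n => C * ‖g n‖) (fun n => ?_) ?_
  · exact (norm_inner_le_norm _ _).trans (mul_le_mul_of_nonneg_right (hf n) (norm_nonneg _))
  · simpa using hg.norm.const_mul C

/-- Split `g n` into its limit, where weak convergence applies, and a remainder tending to zero in
norm, which is harmless because `f` is bounded. -/
theorem WeakTo.tendsto_inner [CompleteSpace E] {f g : ℕ → E} {f' g' : E} (hf : WeakTo f f')
    (hg : Tendsto g atTop (𝓝 g')) :
    Tendsto (fun n => inner ℝ (f n) (g n)) atTop (𝓝 (inner ℝ f' g')) := by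
  obtain ⟨C, -, hC⟩ := hf.bounded
  have h1 := tendsto_inner_of_bounded_of_tendsto hC (tendsto_sub_nhds_zero_iff.2 hg)
  have h2 := (hf g').add h1
  simp only [inner_sub_right, add_zero] at h2
  rw [real_inner_comm] at h2
  refine h2.congr fun n => ?_
  rw [real_inner_comm g' (f n)]
  ring

end Hilbert

variable {d : ℕ}

theorem inner_eq_integral (f g : L2 d) : inner ℝ f g = ∫ x, f x * g x := by
  rw [L2.inner_def]
  exact integral_congr_ae (Eventually.of_forall fun x => by simp [mul_comm])

theorem norm_sq_eq_integral (f : L2 d) : ‖f‖ ^ 2 = ∫ x, f x * f x := by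
  rw [← inner_eq_integral, real_inner_self_eq_norm_sq]

/-- Dominated convergence in `L_2`. -/
theorem tendsto_Lp_of_dominated {f : ℕ → L2 d} {g : L2 d} {G : Pt d → ℝ} (hG : MemLp G 2 volume)
    (hb : ∀ n, ∀ᵐ x, |f n x| ≤ G x) (hl : ∀ᵐ x, Tendsto (fun n => f n x) atTop (𝓝 (g x))) :
    Tendsto f atTop (𝓝 g) := by
  rw [tendsto_iff_norm_sub_tendsto_zero]
  have hb' : ∀ᵐ x, ∀ n, |f n x| ≤ G x := ae_all_iff.2 hb
  have key : Tendsto (fun n => ∫ x, (f n x - g x) * (f n x - g x)) atTop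
      (𝓝 (∫ _ : Pt d, (0 : ℝ))) := by
    refine tendsto_integral_of_dominated_convergence (fun x => (2 * G x) * (2 * G x)) ?_ ?_ ?_ ?_
    · intro n
      have := (Lp.aestronglyMeasurable (f n)).sub (Lp.aestronglyMeasurable g)
      exact this.mul this
    · exact (hG.const_mul 2).integrable_mul (hG.const_mul 2)
    · intro n
      filter_upwards [hb', hl] with x hx hx'
      have hg : |g x| ≤ G x := le_of_tendsto hx'.abs (Eventually.of_forall hx)
      have h3 : |f n x - g x| ≤ 2 * G x := by
        refine (abs_sub _ _).trans ?_
        linarith [hx n]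
      rw [Real.norm_eq_abs, abs_mul]
      exact mul_le_mul h3 h3 (abs_nonneg _) ((abs_nonneg _).trans h3)
    · filter_upwards [hl] with x hx
      have := (tendsto_sub_nhds_zero_iff.2 hx)
      simpa using this.mul this
  rw [integral_zero] at key
  have h2 : Tendsto (fun n => ‖f n - g‖ ^ 2) atTop (𝓝 0) := by
    refine key.congr fun n => ?_
    rw [norm_sq_eq_integral]
    refine integral_congr_ae ?_
    filter_upwards [Lp.coeFn_sub (f n) g] with x hx
    rw [hx, Pi.sub_apply]
  have h3 := h2.sqrt
  simpa [Real.sqrt_sq] using h3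

/-- Multiplication by bounded functions preserves `L_2`. -/
theorem memLp_bdd_mul {m f : Pt d → ℝ} {C : ℝ} (hm : AEStronglyMeasurable m volume)
    (hC : ∀ᵐ x, |m x| ≤ C) (hf : MemLp f 2 volume) : MemLp (fun x => m x * f x) 2 volume := by
  refine hf.of_le_mul (c := C) (hm.mul hf.1) ?_
  filter_upwards [hC] with x hx
  rw [norm_mul]
  exact mul_le_mul_of_nonneg_right hx (norm_nonneg _)

/-! ### Translations -/

/-- Translation of an `L_2`-function by a vector. -/
def translate (a : Pt d) : L2 d →ₗᵢ[ℝ] L2 d :=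
  Lp.compMeasurePreservingₗᵢ ℝ (fun x => x + a) (measurePreserving_add_right volume a)

theorem coeFn_translate (a : Pt d) (f : L2 d) : translate a f =ᵐ[volume] fun x => f (x + a) :=
  Lp.coeFn_compMeasurePreserving f (measurePreserving_add_right volume a)

theorem ae_add_right {P : Pt d → Prop} (h : ∀ᵐ x, P x) (a : Pt d) : ∀ᵐ x, P (x + a) :=
  (measurePreserving_add_right volume a).quasiMeasurePreserving.ae h

theorem continuous_translate (f : L2 d) : Continuous fun a : Pt d => translate a f := by
  -- Currying makes the translation depend continuously on its vector in the compact-open topology,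
  -- as the continuity criterion for compositions in `Lp` requires.
  let g : C(Pt d, C(Pt d, Pt d)) :=
    ContinuousMap.curry ⟨fun p : Pt d × Pt d => p.2 + p.1, by fun_prop⟩
  exact (continuous_const (y := f)).compMeasurePreservingLp (X := Pt d) (Z := Pt d) g.continuous
    (fun a => measurePreserving_add_right volume a) (by simp)

theorem translate_zero (f : L2 d) : translate 0 f = f := by
  refine Lp.ext ?_
  filter_upwards [coeFn_translate 0 f] with x hx
  simpa using hx

theorem inner_translate (a : Pt d) (f g : L2 d) :
    inner ℝ f (translate a g) = inner ℝ (translate (-a) f) g := by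
  rw [inner_eq_integral, inner_eq_integral]
  rw [← integral_add_right_eq_self (fun x => translate (-a) f x * g x) a]
  refine integral_congr_ae ?_
  filter_upwards [coeFn_translate a g, ae_add_right (coeFn_translate (-a) f) a] with x h1 h2
  rw [h1, h2]
  simp

theorem tendsto_translate {f : ℕ → L2 d} {f' : L2 d} (hf : Tendsto f atTop (𝓝 f'))
    {a : ℕ → Pt d} (ha : Tendsto a atTop (𝓝 0)) :
    Tendsto (fun n => translate (a n) (f n)) atTop (𝓝 f') := by
  have h1 : Tendsto (fun n => translate (a n) f') atTop (𝓝 f') := by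
    have := ((continuous_translate f').tendsto 0).comp ha
    rwa [translate_zero] at this
  have h2 : Tendsto (fun n => translate (a n) (f n - f')) atTop (𝓝 0) := by
    rw [tendsto_zero_iff_norm_tendsto_zero]
    simp only [LinearIsometry.norm_map]
    exact tendsto_iff_norm_sub_tendsto_zero.1 hf
  simpa using h2.add h1

/-! ### Components of weakly convergent sequences in `W_2^1` -/

/-- Pairing a component with a fixed `L_2`-function is a continuous functional on `W12`, so no
description of the dual space is needed. -/
theorem WeaklyConverges.component {v : ℕ → W12 d} {v' : W12 d} (h : WeaklyConverges v v')
    (o : Option (Fin d)) :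
    WeakTo (fun n => (v n : L2Tuple d) o) ((v' : L2Tuple d) o) := by
  intro φ
  let ℓ : W12 d →L[ℝ] ℝ := (innerSL ℝ φ).comp
    ((PiLp.proj 2 (fun _ : Option (Fin d) => L2 d) o : L2Tuple d →L[ℝ] L2 d).comp
      (W12 d).subtypeL)
  exact ((WeakBilin.eval_continuous (topDualPairing ℝ (W12 d)).flip ℓ).tendsto _).comp h

theorem tendsto_component {v : ℕ → W12 d} {v' : W12 d} (h : Tendsto v atTop (𝓝 v'))
    (o : Option (Fin d)) :
    Tendsto (fun n => (v n : L2Tuple d) o) atTop (𝓝 ((v' : L2Tuple d) o)) := by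
  have hc : Continuous fun w : W12 d => (w : L2Tuple d) o :=
    (PiLp.continuous_apply 2 (fun _ : Option (Fin d) => L2 d) o).comp continuous_subtype_val
  exact (hc.tendsto v').comp h

/-! ### Averages of translates -/

/-- The average of the translates of `f` by the vectors of the segment from `0` to `a`. -/
def segmentAverage (a : Pt d) (f : L2 d) : L2 d := ∫ s in (0 : ℝ)..1, translate (s • a) f

theorem continuous_translate_smul (a : Pt d) (f : L2 d) :
    Continuous fun s : ℝ => translate (s • a) f :=
  (continuous_translate f).comp (by fun_prop)

theorem norm_segmentAverage_le (a : Pt d) (f : L2 d) : ‖segmentAverage a f‖ ≤ ‖f‖ := by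
  have := intervalIntegral.norm_integral_le_of_norm_le_const (a := 0) (b := 1) (C := ‖f‖)
    (f := fun s : ℝ => translate (s • a) f) (fun s _ => by rw [LinearIsometry.norm_map])
  simpa [segmentAverage] using this

theorem segmentAverage_sub (a : Pt d) (f g : L2 d) :
    segmentAverage a (f - g) = segmentAverage a f - segmentAverage a g := by
  simp only [segmentAverage, map_sub]
  exact intervalIntegral.integral_sub
    ((continuous_translate_smul a f).intervalIntegrable _ _)
    ((continuous_translate_smul a g).intervalIntegrable _ _)

theorem inner_segmentAverage (a : Pt d) (φ f : L2 d) :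
    inner ℝ φ (segmentAverage a f) = ∫ s in (0 : ℝ)..1, inner ℝ φ (translate (s • a) f) :=
  ((innerSL ℝ φ).intervalIntegral_comp_comm
    ((continuous_translate_smul a f).intervalIntegrable 0 1)).symm

/-- Each translation has the opposite translation as adjoint. This moves the average onto the fixed
test element, where it converges strongly, and so gives the weak limit of averages. -/
theorem inner_segmentAverage_comm (a : Pt d) (φ f : L2 d) :
    inner ℝ φ (segmentAverage a f) = inner ℝ (segmentAverage (-a) φ) f := by
  rw [inner_segmentAverage, real_inner_comm, inner_segmentAverage]
  refine intervalIntegral.integral_congr fun s _ => ?_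
  rw [inner_translate, real_inner_comm, smul_neg]

theorem tendsto_segmentAverage_const (f : L2 d) {a : ℕ → Pt d} (ha : Tendsto a atTop (𝓝 0)) :
    Tendsto (fun n => segmentAverage (a n) f) atTop (𝓝 f) := by
  rw [Metric.tendsto_atTop]
  intro ε hε
  have h0 : ∀ᶠ b in 𝓝 (0 : Pt d), ‖translate b f - f‖ < ε / 2 := by
    have h := (continuous_translate f).tendsto 0
    rw [translate_zero, tendsto_iff_norm_sub_tendsto_zero] at h
    exact h.eventually_lt_const (half_pos hε)
  obtain ⟨δ, hδ, hball⟩ := Metric.eventually_nhds_iff.1 h0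
  obtain ⟨N, hN⟩ := Metric.tendsto_atTop.1 ha δ hδ
  refine ⟨N, fun n hn => ?_⟩
  have h1 : segmentAverage (a n) f - f = ∫ s in (0 : ℝ)..1, (translate (s • a n) f - f) := by
    rw [intervalIntegral.integral_sub
      ((continuous_translate_smul (a n) f).intervalIntegrable _ _) (by simp)]
    simp [segmentAverage]
  rw [dist_eq_norm, h1]
  refine (intervalIntegral.norm_integral_le_of_norm_le_const (C := ε / 2) fun s hs => ?_).trans_lt
    (by simpa using hε)
  refine (hball ?_).le
  rw [Set.uIoc_of_le zero_le_one] at hs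
  have := hN n hn
  rw [dist_zero_right] at this ⊢
  rw [norm_smul, Real.norm_eq_abs, abs_of_pos hs.1]
  exact (mul_le_of_le_one_left (norm_nonneg _) hs.2).trans_lt this

theorem tendsto_segmentAverage {f : ℕ → L2 d} {f' : L2 d} (hf : Tendsto f atTop (𝓝 f'))
    {a : ℕ → Pt d} (ha : Tendsto a atTop (𝓝 0)) :
    Tendsto (fun n => segmentAverage (a n) (f n)) atTop (𝓝 f') := by
  have h : Tendsto (fun n => segmentAverage (a n) (f n - f')) atTop (𝓝 0) :=
    squeeze_zero_norm (fun n => norm_segmentAverage_le _ _)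
      (tendsto_iff_norm_sub_tendsto_zero.1 hf)
  simpa [segmentAverage_sub] using h.add (tendsto_segmentAverage_const f' ha)

theorem weakTo_segmentAverage {f : ℕ → L2 d} {f' : L2 d} (hf : WeakTo f f')
    {a : ℕ → Pt d} (ha : Tendsto a atTop (𝓝 0)) :
    WeakTo (fun n => segmentAverage (a n) (f n)) f' := by
  intro φ
  have ha' : Tendsto (fun n => -a n) atTop (𝓝 0) := by simpa using ha.neg
  have := hf.tendsto_inner (tendsto_segmentAverage_const φ ha')
  rw [real_inner_comm] at this
  refine this.congr fun n => ?_
  rw [inner_segmentAverage_comm, real_inner_comm, neg_neg]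

/-! ### Difference quotients of functions in `W_2^1` -/

theorem dense_test : Dense {f : L2 d | ∃ φ : Pt d → ℝ, f =ᵐ[volume] φ ∧ IsTest φ} := by
  refine (Lp.dense_hasCompactSupport_contDiff (E := Pt d) (F := ℝ) (μ := volume) (p := 2)
    (by simp)).mono ?_
  rintro f ⟨g, h1, h2, h3⟩
  exact ⟨g, h1, h3, h2⟩

theorem IsTest.comp_sub {φ : Pt d → ℝ} (h : IsTest φ) (a : Pt d) :
    IsTest fun x => φ (x - a) := by
  refine ⟨h.1.comp (contDiff_id.sub contDiff_const), ?_⟩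
  have := h.2.comp_homeomorph (Homeomorph.subRight a)
  exact this

theorem partialDeriv_comp_sub (φ : Pt d → ℝ) (i : Fin d) (a x : Pt d) :
    partialDeriv i (fun x => φ (x - a)) x = partialDeriv i φ (x - a) := by
  unfold partialDeriv
  rw [fderiv_comp_sub]

theorem IsTest.hasDerivAt_line {φ : Pt d → ℝ} (h : IsTest φ) (i : Fin d) (t : ℝ) (x : Pt d)
    (s : ℝ) : HasDerivAt (fun s : ℝ => φ (x - s • Pi.single i t))
      (-(t * partialDeriv i φ (x - s • Pi.single i t))) s := by
  have h1 : HasFDerivAt φ (fderiv ℝ φ (x - s • Pi.single i t)) (x - s • Pi.single i t) :=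
    (h.1.differentiable (by simp) _).hasFDerivAt
  have h2 : HasDerivAt (fun s : ℝ => x - s • (Pi.single i t : Pt d)) (-(Pi.single i t)) s := by
    simpa using ((hasDerivAt_id s).smul_const (Pi.single i t : Pt d)).const_sub x
  have h3 := h1.comp_hasDerivAt s h2
  have : (Pi.single i t : Pt d) = t • Pi.single i 1 := by
    rw [← Pi.single_smul, smul_eq_mul, mul_one]
  have h4 : fderiv ℝ φ (x - s • Pi.single i t) (-Pi.single i t)
      = -(t * partialDeriv i φ (x - s • Pi.single i t)) := by
    rw [map_neg, partialDeriv, ← smul_eq_mul, ← map_smul, ← this]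
  rw [← h4]
  exact h3

/-- The pairing of a translated test function with `f`, differentiated along the translation. -/
theorem IsTest.hasDerivAt_pairing {φ : Pt d → ℝ} (h : IsTest φ) (i : Fin d) (t : ℝ) (f : L2 d)
    (s : ℝ) : HasDerivAt (fun s : ℝ => ∫ x, f x * φ (x - s • Pi.single i t))
      (∫ x, f x * -(t * partialDeriv i φ (x - s • Pi.single i t))) s := by
  have hcd : Continuous (partialDeriv i φ) :=
    (h.1.continuous_fderiv (by simp)).clm_apply continuous_const
  have hcs : HasCompactSupport (partialDeriv i φ) := h.2.fderiv_apply ℝ (Pi.single i 1)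
  obtain ⟨M, hM⟩ := hcs.exists_bound_of_continuous hcd
  -- `K` contains the supports of all translates with parameter within distance one of `s`, which
  -- gives one integrable bound for differentiation under the integral.
  let K : Set (Pt d) := (fun p : Pt d × ℝ => p.1 + p.2 • (Pi.single i t : Pt d)) ''
    (tsupport (partialDeriv i φ) ×ˢ Set.Icc (s - 1) (s + 1))
  have hK : IsCompact K := (hcs.isCompact.prod isCompact_Icc).image (by fun_prop)
  have hfm := Lp.aestronglyMeasurable f
  have hcont : ∀ s : ℝ, Continuous fun x : Pt d => φ (x - s • Pi.single i t) := fun s =>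
    h.1.continuous.comp (by fun_prop)
  have hcont' : ∀ s : ℝ, Continuous fun x : Pt d => partialDeriv i φ (x - s • Pi.single i t) :=
    fun s => hcd.comp (by fun_prop)
  refine (hasDerivAt_integral_of_dominated_loc_of_deriv_le (μ := (volume : Measure (Pt d)))
    (s := Set.Icc (s - 1) (s + 1))
    (F := fun s x => f x * φ (x - s • Pi.single i t))
    (F' := fun s x => f x * -(t * partialDeriv i φ (x - s • Pi.single i t)))
    (bound := fun x => ‖f x‖ * K.indicator (fun _ => |t| * M) x)
    (Icc_mem_nhds (by linarith) (by linarith)) ?_ ?_ ?_ ?_ ?_ ?_).2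
  · exact Eventually.of_forall fun r => hfm.mul (hcont r).aestronglyMeasurable
  · exact (Lp.memLp f).integrable_mul (h.comp_sub _).memLp
  · exact hfm.mul (((hcont' s).const_mul t).neg).aestronglyMeasurable
  · refine Eventually.of_forall fun x r hr => ?_
    rw [norm_mul]
    refine mul_le_mul_of_nonneg_left ?_ (norm_nonneg _)
    by_cases hx : x - r • Pi.single i t ∈ tsupport (partialDeriv i φ)
    · have hxK : x ∈ K := ⟨(x - r • Pi.single i t, r), ⟨hx, hr⟩, by simp⟩
      rw [Set.indicator_of_mem hxK, norm_neg, norm_mul, Real.norm_eq_abs]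
      exact mul_le_mul_of_nonneg_left (hM _) (abs_nonneg _)
    · rw [image_eq_zero_of_notMem_tsupport hx, mul_zero, neg_zero, norm_zero]
      exact Set.indicator_nonneg
        (fun _ _ => mul_nonneg (abs_nonneg _) ((norm_nonneg _).trans (hM x))) _
  · exact (Lp.memLp f).norm.integrable_mul
      (memLp_indicator_const 2 hK.measurableSet _ (Or.inr hK.measure_lt_top.ne))
  · refine Eventually.of_forall fun x r _ => ?_
    exact (h.hasDerivAt_line i t x r).const_mul (f x)

/-- Against a test function, the translate by `s • Pi.single i t` is differentiable in `s`: the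
derivative falls on the test function and is moved back by the definition of the weak derivative.
Integration over `[0, 1]` and density of test functions give the identity in `L_2`. -/
theorem translate_sub_eq_segmentAverage (F : W12 d) (i : Fin d) (t : ℝ) :
    translate (Pi.single i t) ((F : L2Tuple d) none) - (F : L2Tuple d) none
      = t • segmentAverage (Pi.single i t) ((F : L2Tuple d) (some i)) := by
  refine dense_test.eq_of_inner_right ℝ fun Φ hΦ => ?_
  obtain ⟨φ, hφ, htest⟩ := hΦ
  have hpair : ∀ (g : L2 d) (s : ℝ), inner ℝ Φ (translate (s • Pi.single i t) g)
      = ∫ x, g x * φ (x - s • Pi.single i t) := by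
    intro g s
    rw [inner_translate, real_inner_comm, inner_eq_integral]
    refine integral_congr_ae ?_
    filter_upwards [coeFn_translate (-(s • Pi.single i t)) Φ,
      ae_add_right hφ (-(s • Pi.single i t))] with x h1 h2
    rw [h1, h2, sub_eq_add_neg]
  have hderiv : ∀ s : ℝ, HasDerivAt
      (fun s : ℝ => ∫ x, (F : L2Tuple d) none x * φ (x - s • Pi.single i t))
      (t * inner ℝ Φ (translate (s • Pi.single i t) ((F : L2Tuple d) (some i)))) s := by
    intro s
    convert htest.hasDerivAt_pairing i t ((F : L2Tuple d) none) s using 1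
    have h1 := F.2 i _ (htest.comp_sub (s • Pi.single i t))
    simp only [partialDeriv_comp_sub] at h1
    rw [hpair, ← neg_eq_iff_eq_neg.2 h1, ← integral_neg, ← integral_const_mul]
    refine integral_congr_ae (Eventually.of_forall fun x => ?_)
    change t * -(_ * _) = _ * -(t * _)
    ring
  have hftc := intervalIntegral.integral_eq_sub_of_hasDerivAt (a := 0) (b := 1)
    (fun s _ => hderiv s) (by
      refine Continuous.intervalIntegrable ?_ _ _
      exact ((continuous_const (y := Φ)).inner (continuous_translate_smul _ _)).const_mul t)
  rw [intervalIntegral.integral_const_mul, ← inner_segmentAverage, ← hpair, ← hpair] at hftc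
  rw [inner_sub_right, real_inner_smul_right, hftc]
  simp [translate_zero]

/-- The difference quotient with step `t` in direction `i` of an `L_2`-function. -/
def diffL2 (i : Fin d) (t : ℝ) (f : L2 d) : L2 d := t⁻¹ • (translate (Pi.single i t) f - f)

theorem diffL2_eq_segmentAverage (F : W12 d) (i : Fin d) {t : ℝ} (ht : t ≠ 0) :
    diffL2 i t ((F : L2Tuple d) none)
      = segmentAverage (Pi.single i t) ((F : L2Tuple d) (some i)) := by
  rw [diffL2, translate_sub_eq_segmentAverage, smul_smul, inv_mul_cancel₀ ht, one_smul]

theorem tendsto_single_zero (i : Fin d) {t : ℕ → ℝ} (ht : Tendsto t atTop (𝓝 0)) :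
    Tendsto (fun n => (Pi.single i (t n) : Pt d)) atTop (𝓝 0) := by
  have := ((continuous_single (A := fun _ : Fin d => ℝ) i).tendsto 0).comp ht
  simpa [Function.comp_def] using this

theorem WeaklyConverges.diffL2 {v : ℕ → W12 d} {v' : W12 d} (h : WeaklyConverges v v')
    (i : Fin d) {t : ℕ → ℝ} (ht0 : ∀ n, t n ≠ 0) (ht : Tendsto t atTop (𝓝 0)) :
    WeakTo (fun n => diffL2 i (t n) ((v n : L2Tuple d) none)) ((v' : L2Tuple d) (some i)) := by
  simp only [fun n => diffL2_eq_segmentAverage (v n) i (ht0 n)]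
  exact weakTo_segmentAverage (h.component (some i)) (tendsto_single_zero i ht)

theorem tendsto_diffL2 {v : ℕ → W12 d} {v' : W12 d} (h : Tendsto v atTop (𝓝 v'))
    (i : Fin d) {t : ℕ → ℝ} (ht0 : ∀ n, t n ≠ 0) (ht : Tendsto t atTop (𝓝 0)) :
    Tendsto (fun n => diffL2 i (t n) ((v n : L2Tuple d) none)) atTop
      (𝓝 ((v' : L2Tuple d) (some i))) := by
  simp only [fun n => diffL2_eq_segmentAverage (v n) i (ht0 n)]
  exact tendsto_segmentAverage (tendsto_component h (some i)) (tendsto_single_zero i ht)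

/-! ### Step functions and hat-function sums on the unit grid -/

/-- The multi-index of the unit cell that contains `y`. -/
def idxFloor (y : Pt d) : Idx d := fun i => ⌊y i⌋

/-- The function that equals `w j` on the unit cell with lower corner `j`. -/
def stepFn (w : Idx d → ℝ) (y : Pt d) : ℝ := w (idxFloor y)

/-- The sum of hat functions on the unit grid with coefficients `w`. -/
def hatSum (w : Idx d → ℝ) (y : Pt d) : ℝ := ∑' j : Idx d, w j * ∏ i, hat (y i - j i)

/-- The vertices of the unit cube. -/
def vert (α : Fin d → Bool) : Idx d := fun i => if α i then 1 else 0

/-- The linear shape functions of the unit interval. -/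
def shape (b : Bool) (t : ℝ) : ℝ := if b then t else 1 - t

/-- The weight with which the vertex `α` of its cell contributes to a hat-function sum at `y`. -/
def weight (α : Fin d → Bool) (y : Pt d) : ℝ := ∏ i, shape (α i) (Int.fract (y i))

theorem continuous_shape (b : Bool) : Continuous (shape b) := by
  unfold shape; cases b <;> simp <;> fun_prop

theorem vert_injective : Function.Injective (vert (d := d)) := by
  intro α β h
  funext i
  have := congrFun h i
  unfold vert at this
  revert this
  cases α i <;> cases β i <;> simp

theorem hat_eq_zero {t : ℝ} (h : 1 ≤ |t|) : hat t = 0 := by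
  unfold hat; exact max_eq_left (by linarith)

theorem hat_sub_floor_add (t : ℝ) (b : Bool) :
    hat (t - ((⌊t⌋ + if b then 1 else 0 : ℤ) : ℝ)) = shape b (Int.fract t) := by
  have h0 := Int.fract_nonneg t
  have h1 := Int.fract_lt_one t
  have h2 : t - ⌊t⌋ = Int.fract t := rfl
  unfold hat shape
  cases b
  · simp only [Bool.false_eq_true, if_false, add_zero, h2]
    rw [abs_of_nonneg h0, max_eq_right (by linarith)]
  · simp only [if_true]
    push_cast
    rw [← sub_sub, h2, abs_of_nonpos (by linarith), max_eq_right (by linarith)]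
    ring

theorem hat_sub_int_eq_zero {t : ℝ} {m : ℤ} (h0 : m ≠ ⌊t⌋) (h1 : m ≠ ⌊t⌋ + 1) :
    hat (t - m) = 0 := by
  apply hat_eq_zero
  have ha := Int.floor_le t
  have hb := Int.lt_floor_add_one t
  rcases lt_or_gt_of_ne h0 with h | h
  · have : (m : ℝ) + 1 ≤ ⌊t⌋ := by exact_mod_cast h
    rw [le_abs]; left; linarith
  · have : (⌊t⌋ : ℝ) + 1 + 1 ≤ m := by
      have : ⌊t⌋ + 1 + 1 ≤ m := by omega
      exact_mod_cast this
    rw [le_abs]; right; linarith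

/-- Only the hats at the vertices of the cell containing `y` are nonzero there; on that cell each
one-dimensional factor is a linear shape function of the fractional part. -/
theorem hatSum_eq_sum (w : Idx d → ℝ) (y : Pt d) :
    hatSum w y = ∑ α : Fin d → Bool, weight α y * w (idxFloor y + vert α) := by
  have hinj : Function.Injective fun α : Fin d → Bool => idxFloor y + vert α :=
    (add_right_injective _).comp vert_injective
  rw [hatSum, ← hinj.tsum_eq, tsum_fintype]
  · refine Finset.sum_congr rfl fun α _ => ?_
    rw [mul_comm]
    congr 1
    refine Finset.prod_congr rfl fun i _ => ?_
    exact hat_sub_floor_add (y i) (α i)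
  · intro j hj
    have hj' : ∀ i, hat (y i - j i) ≠ 0 := fun i hi =>
      hj (mul_eq_zero_of_right _ (Finset.prod_eq_zero (Finset.mem_univ i) hi))
    have hcases : ∀ i, j i = ⌊y i⌋ ∨ j i = ⌊y i⌋ + 1 := fun i => by
      by_contra hcon
      rw [not_or] at hcon
      exact hj' i (hat_sub_int_eq_zero hcon.1 hcon.2)
    refine ⟨fun i => decide (j i = ⌊y i⌋ + 1), ?_⟩
    funext i
    simp only [Pi.add_apply, idxFloor, vert, decide_eq_true_eq]
    rcases hcases i with h | h
    · rw [if_neg (by omega), h, add_zero]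
    · rw [if_pos h, h]

theorem weight_nonneg (α : Fin d → Bool) (y : Pt d) : 0 ≤ weight α y := by
  refine Finset.prod_nonneg fun i _ => ?_
  have h0 := Int.fract_nonneg (y i)
  have h1 := Int.fract_lt_one (y i)
  unfold shape
  split_ifs <;> linarith

theorem sum_weight (y : Pt d) : ∑ α : Fin d → Bool, weight α y = 1 := by
  have := Finset.prod_univ_sum (fun _ : Fin d => (Finset.univ : Finset Bool))
    (fun i b => shape b (Int.fract (y i)))
  rw [Fintype.piFinset_univ] at this
  unfold weight
  rw [← this]
  simp [shape]

theorem abs_weight_le_one (α : Fin d → Bool) (y : Pt d) : |weight α y| ≤ 1 := by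
  rw [abs_of_nonneg (weight_nonneg α y), ← sum_weight y]
  exact Finset.single_le_sum (fun β _ => weight_nonneg β y) (Finset.mem_univ α)

theorem weight_add_int (α : Fin d → Bool) (y : Pt d) (m : Idx d) :
    weight α (fun i => y i + m i) = weight α y := by
  simp [weight]

theorem measurable_idxFloor : Measurable (idxFloor (d := d)) :=
  measurable_pi_lambda _ fun i => Int.measurable_floor.comp (measurable_pi_apply i)

theorem measurable_stepFn (w : Idx d → ℝ) : Measurable (stepFn w) :=
  Measurable.of_discrete.comp measurable_idxFloor

theorem measurable_weight (α : Fin d → Bool) : Measurable (weight α) :=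
  Finset.measurable_prod _ fun i _ =>
    (continuous_shape _).measurable.comp (measurable_fract.comp (measurable_pi_apply i))

theorem stepFn_add_int (w : Idx d → ℝ) (y : Pt d) (m : Idx d) :
    stepFn w (fun i => y i + m i) = w (idxFloor y + m) := by
  unfold stepFn
  congr 1
  funext i
  simp [idxFloor]

/-! ### Cells -/

/-- The unit cell with lower corner `j`. -/
def cell (j : Idx d) : Set (Pt d) := Set.pi Set.univ fun i => Set.Ico (j i : ℝ) (j i + 1)

theorem mem_cell {j : Idx d} {y : Pt d} : y ∈ cell j ↔ idxFloor y = j := by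
  simp only [cell, Set.mem_univ_pi, Set.mem_Ico, funext_iff, idxFloor, Int.floor_eq_iff]

theorem measurableSet_cell (j : Idx d) : MeasurableSet (cell j) :=
  MeasurableSet.univ_pi fun _ => measurableSet_Ico

theorem pairwise_disjoint_cell : Pairwise (Function.onFun Disjoint (cell (d := d))) := by
  intro j k hjk
  refine Set.disjoint_left.2 fun y hy hy' => hjk ?_
  rw [mem_cell] at hy hy'
  exact hy.symm.trans hy'

theorem iUnion_cell : ⋃ j, cell (d := d) j = Set.univ :=
  Set.eq_univ_of_forall fun y => Set.mem_iUnion.2 ⟨idxFloor y, mem_cell.2 rfl⟩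

theorem volume_cell (j : Idx d) : volume (cell j) = 1 := by
  simp [cell, Real.volume_pi_Ico]

/-- The unit cells partition space and have volume one, so countable additivity of the integral is
the summation over indices. -/
theorem hasSum_of_integrable_stepFn {F : Idx d → ℝ} (hF : Integrable (stepFn F)) :
    HasSum F (∫ y, stepFn F y) := by
  have h := hasSum_integral_iUnion (μ := volume) (f := stepFn F) measurableSet_cell
    pairwise_disjoint_cell hF.integrableOn
  rw [iUnion_cell, setIntegral_univ] at h
  have hc : ∀ j, ∫ y in cell j, stepFn F y = F j := fun j => by
    rw [setIntegral_congr_fun (measurableSet_cell j) (g := fun _ => F j)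
      (fun y hy => by simp only [stepFn, mem_cell.1 hy])]
    simp [Measure.real, volume_cell]
  simpa only [hc] using h

theorem lintegral_eq_tsum_cell (f : Pt d → ENNReal) :
    ∫⁻ y, f y = ∑' j : Idx d, ∫⁻ y in cell j, f y := by
  rw [← lintegral_iUnion measurableSet_cell pairwise_disjoint_cell, iUnion_cell,
    setLIntegral_univ]

theorem setIntegral_cell_prod (j : Idx d) (f : Fin d → ℝ → ℝ) :
    ∫ y in cell j, ∏ i, f i (y i) = ∏ i, ∫ t in (j i : ℝ)..(j i + 1), f i t := by
  have hr : (volume : Measure (Pt d)).restrict (cell j)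
      = Measure.pi fun i => (volume : Measure ℝ).restrict (Set.Ico (j i : ℝ) (j i + 1)) :=
    Measure.restrict_pi_pi _ _
  rw [hr, integral_fintype_prod_eq_prod]
  refine Finset.prod_congr rfl fun i _ => ?_
  rw [intervalIntegral.integral_of_le (by linarith), integral_Ico_eq_integral_Ioo,
    integral_Ioc_eq_integral_Ioo]

theorem Continuous.integrableOn_cell {f : Pt d → ℝ} (hf : Continuous f) (j : Idx d) :
    IntegrableOn f (cell j) := by
  have hK : IsCompact (Set.pi Set.univ fun i => Set.Icc (j i : ℝ) (j i + 1)) :=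
    isCompact_univ_pi fun _ => isCompact_Icc
  exact (hf.continuousOn.integrableOn_compact hK).mono_set
    (Set.pi_mono fun _ _ => Set.Ico_subset_Icc_self)

/-! ### Dual functions and control of knot values -/

/-- The function dual to the hat-function sums on the cell `j`. -/
def dualFn (j : Idx d) (y : Pt d) : ℝ := ∏ i, (4 - 6 * (y i - j i))

/-- The factor `4 - 6 * t` is the linear polynomial orthogonal to `t` on `[0, 1]` with integral one
against `1 - t`. Its tensor product therefore selects the lower corner of the cell. -/
theorem integral_dualFn_mul_shape (j : Idx d) (α : Fin d → Bool) :
    ∫ y in cell j, dualFn j y * ∏ i, shape (α i) (y i - j i)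
      = if α = fun _ => false then 1 else 0 := by
  simp only [dualFn, ← Finset.prod_mul_distrib]
  rw [setIntegral_cell_prod j fun i t => (4 - 6 * (t - j i)) * shape (α i) (t - j i)]
  have h1 : ∀ i, ∫ t in (j i : ℝ)..(j i + 1), (4 - 6 * (t - j i)) * shape (α i) (t - j i)
      = if α i = false then 1 else 0 := by
    intro i
    rw [intervalIntegral.integral_comp_sub_right (fun t => (4 - 6 * t) * shape (α i) t)]
    have hp : ∀ b : Bool, ∀ t : ℝ, (4 - 6 * t) * shape b t
        = if b then 4 * t - 6 * t ^ 2 else 4 - 10 * t + 6 * t ^ 2 := by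
      intro b t; unfold shape; split_ifs <;> ring
    have hlin : ∀ c : ℝ, ∫ t in (0 : ℝ)..1, c * t = c * 2⁻¹ := fun c => by
      rw [intervalIntegral.integral_const_mul, integral_id]; norm_num
    simp only [hp, sub_self, add_sub_cancel_left]
    cases α i
    · simp only [Bool.false_eq_true, if_false, if_true]
      rw [intervalIntegral.integral_add, intervalIntegral.integral_sub]
      · simp [hlin]; norm_num
      all_goals exact Continuous.intervalIntegrable (by fun_prop) _ _
    · simp only [if_true, Bool.true_eq_false, if_false]
      rw [intervalIntegral.integral_sub]
      · simp [hlin]; norm_num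
      all_goals exact Continuous.intervalIntegrable (by fun_prop) _ _
  simp only [h1]
  split_ifs with h
  · simp [h]
  · obtain ⟨i, hi⟩ := Function.ne_iff.1 h
    exact Finset.prod_eq_zero (Finset.mem_univ i) (if_neg hi)

theorem integral_dualFn_sq (j : Idx d) : ∫ y in cell j, dualFn j y * dualFn j y = 4 ^ d := by
  simp only [dualFn, ← Finset.prod_mul_distrib]
  rw [setIntegral_cell_prod j fun i t => (4 - 6 * (t - j i)) * (4 - 6 * (t - j i))]
  have h1 : ∀ i, ∫ t in (j i : ℝ)..(j i + 1), (4 - 6 * (t - j i)) * (4 - 6 * (t - j i)) = 4 := by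
    intro i
    rw [intervalIntegral.integral_comp_sub_right (fun t => (4 - 6 * t) * (4 - 6 * t))]
    have hp : ∀ t : ℝ, (4 - 6 * t) * (4 - 6 * t) = 16 - 48 * t + 36 * t ^ 2 := fun t => by ring
    have hlin : ∀ c : ℝ, ∫ t in (0 : ℝ)..1, c * t = c * 2⁻¹ := fun c => by
      rw [intervalIntegral.integral_const_mul, integral_id]; norm_num
    simp only [hp, sub_self, add_sub_cancel_left]
    rw [intervalIntegral.integral_add, intervalIntegral.integral_sub]
    · simp [hlin]; norm_num
    all_goals exact Continuous.intervalIntegrable (by fun_prop) _ _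
  simp [h1]

theorem continuous_dualFn (j : Idx d) : Continuous (dualFn j) := by
  unfold dualFn; fun_prop

/-- The hat-function sum on the cell `j`, as a polynomial. -/
def cellPoly (w : Idx d → ℝ) (j : Idx d) (y : Pt d) : ℝ :=
  ∑ α : Fin d → Bool, (∏ i, shape (α i) (y i - j i)) * w (j + vert α)

theorem hatSum_eq_cellPoly (w : Idx d → ℝ) {j : Idx d} {y : Pt d} (hy : y ∈ cell j) :
    hatSum w y = cellPoly w j y := by
  rw [hatSum_eq_sum, cellPoly]
  obtain rfl := mem_cell.1 hy
  rfl

theorem continuous_cellPoly (w : Idx d → ℝ) (j : Idx d) : Continuous (cellPoly w j) := by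
  unfold cellPoly
  refine continuous_finsetSum _ fun α _ => Continuous.mul ?_ continuous_const
  exact continuous_finsetProd _ fun i _ => (continuous_shape _).comp (by fun_prop)

theorem integral_dualFn_mul_cellPoly (w : Idx d → ℝ) (j : Idx d) :
    ∫ y in cell j, dualFn j y * cellPoly w j y = w j := by
  simp only [cellPoly, Finset.mul_sum, ← mul_assoc]
  rw [integral_finsetSum]
  · simp only [integral_mul_const, integral_dualFn_mul_shape]
    simp only [ite_mul, one_mul, zero_mul, Finset.sum_ite_eq', Finset.mem_univ, if_true]
    congr 1
    funext i
    simp [vert]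
  · intro α _
    refine Continuous.integrableOn_cell ?_ j
    refine ((continuous_dualFn j).mul ?_).mul continuous_const
    exact continuous_finsetProd _ fun i _ => (continuous_shape _).comp (by fun_prop)

/-- The value of a hat-function sum at a knot is controlled by its `L_2`-norm on the cell. -/
theorem sq_le_integral_cellPoly (w : Idx d → ℝ) (j : Idx d) :
    w j ^ 2 ≤ 4 ^ d * ∫ y in cell j, cellPoly w j y ^ 2 := by
  have hc := continuous_cellPoly w j
  have hd := continuous_dualFn (d := d) j
  -- Cauchy-Schwarz by completing the square: `4 ^ d` is the squared norm of the dual function and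
  -- `w j` its pairing with the polynomial, so `κ` is the coefficient of the orthogonal projection.
  set κ : ℝ := w j / 4 ^ d with hκ
  have h0 : 0 ≤ ∫ y in cell j, (cellPoly w j y - κ * dualFn j y) ^ 2 :=
    integral_nonneg fun y => sq_nonneg _
  have h1 : ∀ y, (cellPoly w j y - κ * dualFn j y) ^ 2
      = (cellPoly w j y ^ 2 - 2 * κ * (dualFn j y * cellPoly w j y))
        + κ ^ 2 * (dualFn j y * dualFn j y) := fun y => by ring
  simp only [h1] at h0
  rw [integral_add, integral_sub, integral_const_mul, integral_const_mul,
    integral_dualFn_mul_cellPoly, integral_dualFn_sq] at h0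
  · have h4 : (0 : ℝ) < 4 ^ d := by positivity
    have hw : w j = κ * 4 ^ d := by rw [hκ]; field_simp
    rw [hw] at h0 ⊢
    nlinarith
  all_goals refine Continuous.integrableOn_cell ?_ j; fun_prop

/-- The cellwise bound is summed in `ENNReal`, so finiteness for the step function can be deduced
rather than assumed. -/
theorem lintegral_stepFn_le (w : Idx d → ℝ) :
    ∫⁻ y, ENNReal.ofReal (stepFn w y ^ 2)
      ≤ ENNReal.ofReal (4 ^ d) * ∫⁻ y, ENNReal.ofReal (hatSum w y ^ 2) := by
  rw [lintegral_eq_tsum_cell, lintegral_eq_tsum_cell fun y => ENNReal.ofReal (hatSum w y ^ 2),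
    ← ENNReal.tsum_mul_left]
  refine ENNReal.tsum_le_tsum fun j => ?_
  rw [setLIntegral_congr_fun (measurableSet_cell j)
      (f := fun y => ENNReal.ofReal (stepFn w y ^ 2)) (g := fun _ => ENNReal.ofReal (w j ^ 2))
      (fun y hy => by simp only [stepFn, mem_cell.1 hy]),
    setLIntegral_congr_fun (measurableSet_cell j)
      (f := fun y => ENNReal.ofReal (hatSum w y ^ 2))
      (g := fun y => ENNReal.ofReal (cellPoly w j y ^ 2))
      (fun y hy => by simp only [hatSum_eq_cellPoly w hy]),
    setLIntegral_const, volume_cell, mul_one,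
    ← ofReal_integral_eq_lintegral_ofReal, ← ENNReal.ofReal_mul (by positivity)]
  · exact ENNReal.ofReal_le_ofReal (sq_le_integral_cellPoly w j)
  · exact Continuous.integrableOn_cell ((continuous_cellPoly w j).pow 2) j
  · exact Eventually.of_forall fun y => sq_nonneg _

/-! ### Scaling -/

/-- The affine map that carries the grid with origin `o` and steps `s` to the unit grid. -/
def toGrid (o s : Pt d) (z : Pt d) : Pt d := fun i => (z i - o i) / s i

theorem continuous_toGrid (o s : Pt d) : Continuous (toGrid o s) := by
  unfold toGrid; fun_prop

theorem toGrid_add (o : Pt d) {s : Pt d} (hs : ∀ i, 0 < s i) (z : Pt d) (m : Idx d) :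
    toGrid o s (z + fun i => s i * m i) = fun i => toGrid o s z i + m i := by
  funext i
  have := (hs i).ne'
  simp only [toGrid, Pi.add_apply]
  field_simp
  ring

theorem map_toGrid (o : Pt d) {s : Pt d} (hs : ∀ i, 0 < s i) :
    Measure.map (toGrid o s) volume
      = ENNReal.ofReal (∏ i, s i) • (volume : Measure (Pt d)) := by
  have hdet : (Matrix.diagonal fun i => (s i)⁻¹).det = (∏ i, s i)⁻¹ := by
    rw [Matrix.det_diagonal, Finset.prod_inv_distrib]
  have hpos : 0 < ∏ i, s i := Finset.prod_pos fun i _ => hs i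
  have h1 := Real.smul_map_diagonal_volume_pi (D := fun i => (s i)⁻¹)
    (by rw [hdet]; exact (inv_pos.2 hpos).ne')
  rw [hdet, abs_of_pos (inv_pos.2 hpos)] at h1
  have hcomp : toGrid o s
      = Matrix.toLin' (Matrix.diagonal fun i => (s i)⁻¹) ∘ fun z => z - o := by
    funext z i
    simp [toGrid, Matrix.mulVec_diagonal, div_eq_inv_mul]
  have hlin : Measurable (Matrix.toLin' (Matrix.diagonal fun i => (s i)⁻¹)) :=
    (LinearMap.continuous_of_finiteDimensional _).measurable
  rw [hcomp, ← Measure.map_map hlin (show Measurable fun z : Pt d => z - o from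
    measurable_id.sub_const o)]
  have h2 : Measure.map (fun z : Pt d => z - o) volume = volume :=
    (measurePreserving_sub_right volume o).map_eq
  rw [h2]
  conv_rhs => rw [← h1]
  rw [smul_smul, ← ENNReal.ofReal_mul hpos.le, mul_inv_cancel₀ hpos.ne', ENNReal.ofReal_one,
    one_smul]

theorem lintegral_comp_toGrid (o : Pt d) {s : Pt d} (hs : ∀ i, 0 < s i) {f : Pt d → ENNReal}
    (hf : Measurable f) :
    ∫⁻ z, f (toGrid o s z) = ENNReal.ofReal (∏ i, s i) * ∫⁻ y, f y := by
  rw [← lintegral_map hf (continuous_toGrid o s).measurable, map_toGrid o hs,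
    lintegral_smul_measure, smul_eq_mul]

theorem measurable_hatSum (w : Idx d → ℝ) : Measurable (hatSum w) := by
  have : hatSum w = fun y => ∑ α : Fin d → Bool, weight α y * w (idxFloor y + vert α) :=
    funext (hatSum_eq_sum w)
  rw [this]
  exact Finset.measurable_sum _ fun α _ => (measurable_weight α).mul
    (Measurable.of_discrete (f := fun k => w (k + vert α)) |>.comp measurable_idxFloor)

theorem hasSum_of_integrable_stepFn_toGrid {o s : Pt d} (hs : ∀ i, 0 < s i) {F : Idx d → ℝ}
    (hF : Integrable fun z => stepFn F (toGrid o s z)) :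
    HasSum F ((∏ i, s i)⁻¹ * ∫ z, stepFn F (toGrid o s z)) := by
  have hpos : 0 < ∏ i, s i := Finset.prod_pos fun i _ => hs i
  have hm : AEStronglyMeasurable (stepFn F) (Measure.map (toGrid o s) volume) :=
    (measurable_stepFn F).aestronglyMeasurable
  have hae := (continuous_toGrid o s).measurable.aemeasurable (μ := volume)
  have h1 : Integrable (stepFn F) (Measure.map (toGrid o s) volume) :=
    (integrable_map_measure hm hae).2 hF
  have h2 : Integrable (stepFn F) := by
    rw [map_toGrid o hs, integrable_smul_measure (by simpa using hpos) (by simp)] at h1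
    exact h1
  have h3 : ∫ z, stepFn F (toGrid o s z) = (∏ i, s i) * ∫ y, stepFn F y := by
    rw [← integral_map hae hm, map_toGrid o hs, integral_smul_measure,
      ENNReal.toReal_ofReal hpos.le, smul_eq_mul]
  rw [h3, inv_mul_cancel_left₀ hpos.ne']
  exact hasSum_of_integrable_stepFn h2

/-! ### Step functions and hat-function sums in `L_2` -/

theorem hatSum_sub (w₁ w₂ : Idx d → ℝ) (y : Pt d) :
    hatSum (w₁ - w₂) y = hatSum w₁ y - hatSum w₂ y := by
  simp only [hatSum_eq_sum, Pi.sub_apply, mul_sub, Finset.sum_sub_distrib]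

theorem memLp_two_of_lintegral {f : Pt d → ℝ} (hf : Measurable f)
    (h : ∫⁻ z, ENNReal.ofReal (f z ^ 2) < ⊤) : MemLp f 2 volume := by
  rw [memLp_two_iff_integrable_sq hf.aestronglyMeasurable]
  refine ⟨(hf.pow_const 2).aestronglyMeasurable, ?_⟩
  rw [hasFiniteIntegral_iff_ofReal (Eventually.of_forall fun z => sq_nonneg _)]
  exact h

theorem lintegral_sq_eq (f : L2 d) : ∫⁻ z, ENNReal.ofReal (f z ^ 2) = ENNReal.ofReal (‖f‖ ^ 2) := by
  rw [norm_sq_eq_integral, ofReal_integral_eq_lintegral_ofReal]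
  · simp only [pow_two]
  · exact (Lp.memLp f).integrable_mul (Lp.memLp f)
  · exact Eventually.of_forall fun z => mul_self_nonneg _

/-- If a hat-function sum is in `L_2`, then so is the step function with the same coefficients. -/
theorem exists_stepFn_Lp (o : Pt d) {s : Pt d} (hs : ∀ i, 0 < s i) (w : Idx d → ℝ) (V : L2 d)
    (hV : V =ᵐ[volume] fun z => hatSum w (toGrid o s z)) :
    ∃ W : L2 d, (W =ᵐ[volume] fun z => stepFn w (toGrid o s z)) ∧ ‖W‖ ≤ 2 ^ d * ‖V‖ := by
  have hbound : ∫⁻ z, ENNReal.ofReal (stepFn w (toGrid o s z) ^ 2)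
      ≤ ENNReal.ofReal (4 ^ d * ‖V‖ ^ 2) := by
    rw [ENNReal.ofReal_mul (by positivity), ← lintegral_sq_eq V]
    rw [lintegral_congr_ae (f := fun z => ENNReal.ofReal (V z ^ 2)) (g := fun z => ENNReal.ofReal (hatSum w (toGrid o s z) ^ 2))
      (by filter_upwards [hV] with z hz; rw [hz])]
    rw [lintegral_comp_toGrid o hs (f := fun y => ENNReal.ofReal (stepFn w y ^ 2))
      ((measurable_stepFn w).pow_const 2).ennreal_ofReal,
      lintegral_comp_toGrid o hs (f := fun y => ENNReal.ofReal (hatSum w y ^ 2))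
      ((measurable_hatSum w).pow_const 2).ennreal_ofReal, mul_left_comm]
    exact mul_le_mul_right (lintegral_stepFn_le w) _
  have hmem : MemLp (fun z => stepFn w (toGrid o s z)) 2 volume :=
    memLp_two_of_lintegral ((measurable_stepFn w).comp (continuous_toGrid o s).measurable)
      (hbound.trans_lt ENNReal.ofReal_lt_top)
  refine ⟨hmem.toLp _, hmem.coeFn_toLp, ?_⟩
  have h2 : ENNReal.ofReal (‖hmem.toLp _‖ ^ 2) ≤ ENNReal.ofReal (4 ^ d * ‖V‖ ^ 2) := by
    rw [← lintegral_sq_eq]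
    refine (lintegral_congr_ae ?_).trans_le hbound
    filter_upwards [hmem.coeFn_toLp] with z hz
    rw [hz]
  rw [ENNReal.ofReal_le_ofReal_iff (by positivity)] at h2
  refine (sq_le_sq₀ (norm_nonneg _) (by positivity)).1 ?_
  rwa [mul_pow, ← pow_mul, mul_comm d 2, pow_mul, show (2 : ℝ) ^ 2 = 4 by norm_num]

/-- Multiplication by the periodic weight function of the vertex `α`. -/
def weightMul (o s : Pt d) (α : Fin d → Bool) (f : L2 d) : L2 d :=
  (memLp_bdd_mul (m := fun z => weight α (toGrid o s z)) (C := 1)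
    ((measurable_weight α).comp (continuous_toGrid o s).measurable).aestronglyMeasurable
    (Eventually.of_forall fun _ => abs_weight_le_one α _) (Lp.memLp f)).toLp _

theorem coeFn_weightMul (o s : Pt d) (α : Fin d → Bool) (f : L2 d) :
    weightMul o s α f =ᵐ[volume] fun z => weight α (toGrid o s z) * f z :=
  MemLp.coeFn_toLp _

theorem weightMul_sub (o s : Pt d) (α : Fin d → Bool) (f g : L2 d) :
    weightMul o s α (f - g) = weightMul o s α f - weightMul o s α g := by
  refine Lp.ext ?_
  filter_upwards [coeFn_weightMul o s α f, coeFn_weightMul o s α g,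
    coeFn_weightMul o s α (f - g), Lp.coeFn_sub f g,
    Lp.coeFn_sub (weightMul o s α f) (weightMul o s α g)] with z h1 h2 h3 h4 h5
  rw [h3, h4, h5, Pi.sub_apply, Pi.sub_apply, h1, h2, mul_sub]

theorem norm_weightMul_le (o s : Pt d) (α : Fin d → Bool) (f : L2 d) :
    ‖weightMul o s α f‖ ≤ ‖f‖ := by
  refine Lp.norm_le_norm_of_ae_le ?_
  filter_upwards [coeFn_weightMul o s α f] with z h1
  rw [h1, norm_mul]
  exact mul_le_of_le_one_left (norm_nonneg _) (abs_weight_le_one α _)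

theorem coeFn_finset_sum {ι : Type*} (t : Finset ι) (f : ι → L2 d) :
    (∑ i ∈ t, f i : L2 d) =ᵐ[volume] fun z => ∑ i ∈ t, f i z := by
  classical
  induction t using Finset.induction_on with
  | empty =>
    simp only [Finset.sum_empty]
    exact Lp.coeFn_zero ℝ 2 volume
  | insert i t hi ih =>
    rw [Finset.sum_insert hi]
    filter_upwards [ih, Lp.coeFn_add (f i) (∑ i ∈ t, f i)] with z h1 h2
    rw [h2, Pi.add_apply, h1, Finset.sum_insert hi]

theorem sum_weightMul (o s : Pt d) (f : L2 d) : ∑ α, weightMul o s α f = f := by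
  refine Lp.ext ?_
  filter_upwards [coeFn_finset_sum Finset.univ fun α => weightMul o s α f,
    ae_all_iff.2 fun α => coeFn_weightMul o s α f] with z h1 h2
  rw [h1]
  simp only [h2]
  rw [← Finset.sum_mul, sum_weight, one_mul]

theorem inner_weightMul (o s : Pt d) (α : Fin d → Bool) (f g : L2 d) :
    inner ℝ (weightMul o s α f) g = inner ℝ f (weightMul o s α g) := by
  rw [inner_eq_integral, inner_eq_integral]
  refine integral_congr_ae ?_
  filter_upwards [coeFn_weightMul o s α f, coeFn_weightMul o s α g] with z h1 h2
  rw [h1, h2]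
  ring

/-- The displacement by the multi-index `m` on the grid with steps `s`. -/
def gridShift (s : Pt d) (m : Idx d) : Pt d := fun i => s i * m i

/-- The weights are periodic with respect to the grid, so multiplication by them commutes with grid
translations. -/
theorem weightMul_translate (o : Pt d) {s : Pt d} (hs : ∀ i, 0 < s i) (α : Fin d → Bool)
    (m : Idx d) (f : L2 d) :
    translate (-gridShift s m) (weightMul o s α f)
      = weightMul o s α (translate (-gridShift s m) f) := by
  refine Lp.ext ?_
  have h0 : -gridShift s m = fun i => s i * ((-m) i : ℤ) := by
    funext i; simp [gridShift]
  filter_upwards [coeFn_translate (-gridShift s m) (weightMul o s α f),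
    ae_add_right (coeFn_weightMul o s α f) (-gridShift s m),
    coeFn_weightMul o s α (translate (-gridShift s m) f),
    coeFn_translate (-gridShift s m) f] with z h1 h2 h3 h4
  rw [h1, h2, h3, h4]
  congr 1
  rw [h0, toGrid_add o hs, weight_add_int]

/-- The coefficient at the vertex `α` of a cell is the value of the step function one cell further
in the direction of `α`, that is, of its translate. -/
theorem hatSum_eq_sum_weightMul (o : Pt d) {s : Pt d} (hs : ∀ i, 0 < s i) (w : Idx d → ℝ)
    (W : L2 d) (hW : W =ᵐ[volume] fun z => stepFn w (toGrid o s z)) :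
    (∑ α, weightMul o s α (translate (gridShift s (vert α)) W) : L2 d)
      =ᵐ[volume] fun z => hatSum w (toGrid o s z) := by
  filter_upwards [coeFn_finset_sum Finset.univ fun α =>
      weightMul o s α (translate (gridShift s (vert α)) W),
    ae_all_iff.2 fun α => coeFn_weightMul o s α (translate (gridShift s (vert α)) W),
    ae_all_iff.2 fun α : Fin d → Bool => coeFn_translate (gridShift s (vert α)) W,
    ae_all_iff.2 fun α : Fin d → Bool => ae_add_right hW (gridShift s (vert α))] with z h1 h2 h3 h4
  rw [h1, hatSum_eq_sum]
  refine Finset.sum_congr rfl fun α _ => ?_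
  rw [h2, h3, h4]
  congr 1
  have := toGrid_add o hs z (vert α)
  rw [show gridShift s (vert α) = fun i => s i * vert α i from rfl, this, stepFn_add_int]

/-- Translations and weights are moved to `g` by taking adjoints, and the weights sum to one. The
error then contains only differences between `g` and its small translates. -/
theorem inner_hatSum (o : Pt d) {s : Pt d} (hs : ∀ i, 0 < s i) (w : Idx d → ℝ) (V W : L2 d)
    (hV : V =ᵐ[volume] fun z => hatSum w (toGrid o s z))
    (hW : W =ᵐ[volume] fun z => stepFn w (toGrid o s z)) (g : L2 d) :
    inner ℝ V g - inner ℝ W g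
      = inner ℝ W (∑ α, weightMul o s α (translate (-gridShift s (vert α)) g - g)) := by
  have h1 : V = ∑ α, weightMul o s α (translate (gridShift s (vert α)) W) :=
    Lp.ext (hV.trans (hatSum_eq_sum_weightMul o hs w W hW).symm)
  simp only [weightMul_sub, Finset.sum_sub_distrib, sum_weightMul, inner_sub_right]
  rw [h1, sum_inner, inner_sum]
  congr 1
  refine Finset.sum_congr rfl fun α _ => ?_
  rw [inner_weightMul, real_inner_comm, inner_translate, weightMul_translate o hs,
    real_inner_comm]

theorem tendsto_gridShift {s : ℕ → Pt d} (hs0 : Tendsto s atTop (𝓝 0)) (m : Idx d) :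
    Tendsto (fun n => gridShift (s n) m) atTop (𝓝 0) := by
  rw [tendsto_pi_nhds] at hs0 ⊢
  intro i
  simpa [gridShift] using (hs0 i).mul_const (m i : ℝ)

theorem tendsto_sum_weightMul_translate {o s : ℕ → Pt d} (hs0 : Tendsto s atTop (𝓝 0))
    {m : (Fin d → Bool) → Idx d} {f : ℕ → L2 d} {f' : L2 d} (hf : Tendsto f atTop (𝓝 f')) :
    Tendsto (fun n => ∑ α, weightMul (o n) (s n) α (translate (gridShift (s n) (m α)) (f n) - f'))
      atTop (𝓝 0) := by
  rw [← Finset.sum_const_zero (ι := Fin d → Bool) (s := Finset.univ)]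
  refine tendsto_finsetSum _ fun α _ => ?_
  refine squeeze_zero_norm (fun n => norm_weightMul_le _ _ _ _) ?_
  exact tendsto_iff_norm_sub_tendsto_zero.1 (tendsto_translate hf (tendsto_gridShift hs0 _))

section Sequences

variable {o s : ℕ → Pt d} {w : ℕ → Idx d → ℝ} {V W : ℕ → L2 d} {V' : L2 d}

theorem gridShift_neg (s : Pt d) (m : Idx d) : gridShift s (-m) = -gridShift s m := by
  funext i; simp [gridShift]

/-- Weak convergence carries over from hat-function sums to step functions. -/
theorem weakTo_stepFn (hs : ∀ n i, 0 < s n i) (hs0 : Tendsto s atTop (𝓝 0))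
    (hV : ∀ n, V n =ᵐ[volume] fun z => hatSum (w n) (toGrid (o n) (s n) z))
    (hW : ∀ n, W n =ᵐ[volume] fun z => stepFn (w n) (toGrid (o n) (s n) z))
    (hWV : ∀ n, ‖W n‖ ≤ 2 ^ d * ‖V n‖) (h : WeakTo V V') : WeakTo W V' := by
  obtain ⟨C, hC0, hC⟩ := h.bounded
  intro g
  -- The step functions are bounded by the norm comparison, while the factor acting on the fixed `g`
  -- tends to zero strongly. Hence both sequences have the same pairings in the limit.
  have h1 := tendsto_inner_of_bounded_of_tendsto (f := W) (C := 2 ^ d * C)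
    (fun n => (hWV n).trans (mul_le_mul_of_nonneg_left (hC n) (by positivity)))
    (tendsto_sum_weightMul_translate (o := o) hs0 (m := fun α => -vert α)
      (tendsto_const_nhds (x := g)))
  have h2 := (h g).sub h1
  rw [sub_zero] at h2
  refine h2.congr fun n => ?_
  simp only [gridShift_neg]
  rw [← inner_hatSum (o n) (hs n) (w n) (V n) (W n) (hV n) (hW n) g, real_inner_comm,
    real_inner_comm (W n) g]
  ring

/-! ### Sampling at cell corners and strong convergence -/

/-- The lower corner of the grid cell that contains `z`. -/
def corner (o s z : Pt d) : Pt d := fun i => o i + s i * idxFloor (toGrid o s z) i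

theorem dist_corner_le (o : Pt d) {s : Pt d} (hs : ∀ i, 0 < s i) (z : Pt d) :
    dist (corner o s z) z ≤ ‖s‖ := by
  refine (dist_pi_le_iff (norm_nonneg _)).2 fun i => ?_
  have hi := hs i
  have h1 : corner o s z i - z i = -(s i * Int.fract (toGrid o s z i)) := by
    have h2 : s i * toGrid o s z i = z i - o i := by
      simp only [toGrid]; field_simp
    rw [← Int.self_sub_floor, mul_sub, h2, corner, idxFloor]
    ring
  rw [Real.dist_eq, h1, abs_neg, abs_mul, abs_of_pos hi, abs_of_nonneg (Int.fract_nonneg _)]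
  calc s i * Int.fract (toGrid o s z i) ≤ s i * 1 :=
        mul_le_mul_of_nonneg_left (Int.fract_lt_one _).le hi.le
    _ = ‖s i‖ := by rw [mul_one, Real.norm_eq_abs, abs_of_pos hi]
    _ ≤ ‖s‖ := norm_le_pi_norm s i

theorem tendsto_corner (hs : ∀ n i, 0 < s n i) (hs0 : Tendsto s atTop (𝓝 0)) (z : Pt d) :
    Tendsto (fun n => corner (o n) (s n) z) atTop (𝓝 z) := by
  rw [tendsto_iff_dist_tendsto_zero]
  refine squeeze_zero (fun n => dist_nonneg) (fun n => dist_corner_le (o n) (hs n) z) ?_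
  simpa using hs0.norm

theorem measurable_corner_comp {f : Pt d → ℝ} (o s : Pt d) :
    Measurable fun z => f (corner o s z) :=
  (measurable_stepFn fun j => f fun i => o i + s i * j i).comp (continuous_toGrid o s).measurable

/-- Sampling a test function at the knots. -/
theorem exists_sampled_Lp (hs : ∀ n i, 0 < s n i) (hs0 : Tendsto s atTop (𝓝 0))
    {φ : Pt d → ℝ} (hφ : IsTest φ) (Φ : L2 d) (hΦ : Φ =ᵐ[volume] φ) :
    ∃ B : ℕ → L2 d, (∀ n, B n =ᵐ[volume] fun z => φ (corner (o n) (s n) z)) ∧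
      Tendsto B atTop (𝓝 Φ) := by
  obtain ⟨M, hM⟩ := hφ.2.exists_bound_of_continuous hφ.1.continuous
  obtain ⟨R, hR⟩ := hs0.norm.bddAbove_range
  have hR' : ∀ n, ‖s n‖ ≤ R := fun n => hR ⟨n, rfl⟩
  -- Corners lie within `R` of the points of their cells, so every sampled function vanishes outside
  -- this thickening of the support.
  let K := Metric.cthickening R (tsupport φ)
  have hK : IsCompact K := hφ.2.isCompact.cthickening
  have hG : MemLp (K.indicator fun _ => M) 2 (volume : Measure (Pt d)) :=
    memLp_indicator_const 2 hK.measurableSet _ (Or.inr hK.measure_lt_top.ne)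
  have hb : ∀ n z, |φ (corner (o n) (s n) z)| ≤ K.indicator (fun _ => M) z := by
    intro n z
    by_cases hz : corner (o n) (s n) z ∈ tsupport φ
    · have : z ∈ K := Metric.mem_cthickening_of_dist_le z _ R _ hz
        ((dist_comm _ _).trans_le ((dist_corner_le (o n) (hs n) z).trans (hR' n)))
      rw [Set.indicator_of_mem this]
      exact hM _
    · rw [image_eq_zero_of_notMem_tsupport hz, abs_zero]
      exact Set.indicator_nonneg (fun _ _ => (norm_nonneg _).trans (hM z)) _
  have hmem : ∀ n, MemLp (fun z => φ (corner (o n) (s n) z)) 2 volume := fun n =>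
    hG.mono (measurable_corner_comp _ _).aestronglyMeasurable
      (Eventually.of_forall fun z => (hb n z).trans (le_abs_self _))
  refine ⟨fun n => (hmem n).toLp _, fun n => (hmem n).coeFn_toLp, ?_⟩
  refine tendsto_Lp_of_dominated hG (fun n => ?_) ?_
  · filter_upwards [(hmem n).coeFn_toLp] with z hz
    rw [hz]
    exact hb n z
  · filter_upwards [ae_all_iff.2 fun n => (hmem n).coeFn_toLp, hΦ] with z hz hz'
    simp only [hz, hz']
    exact (hφ.1.continuous.tendsto z).comp (tendsto_corner hs hs0 z)

/-- Strong convergence carries over from hat-function sums to step functions. -/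
theorem tendsto_stepFn (hs : ∀ n i, 0 < s n i) (hs0 : Tendsto s atTop (𝓝 0))
    (hV : ∀ n, V n =ᵐ[volume] fun z => hatSum (w n) (toGrid (o n) (s n) z))
    (hW : ∀ n, W n =ᵐ[volume] fun z => stepFn (w n) (toGrid (o n) (s n) z))
    (h : Tendsto V atTop (𝓝 V')) : Tendsto W atTop (𝓝 V') := by
  rw [Metric.tendsto_atTop]
  intro ε hε
  -- The final error tends to `2 ^ d + 1` times the distance from `V'` to the test function; the
  -- extra factor two makes it strictly less than `ε`.
  have hD : (0 : ℝ) < 2 * (2 ^ d + 1) := by positivity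
  obtain ⟨Φ, hdist, φ, hΦ, hφ⟩ :=
    Metric.dense_iff.1 dense_test V' (ε / (2 * (2 ^ d + 1))) (div_pos hε hD)
  rw [Metric.mem_ball, dist_eq_norm] at hdist
  obtain ⟨B, hB, hBΦ⟩ := exists_sampled_Lp (o := o) hs hs0 hφ Φ hΦ
  let g : ℕ → Idx d → ℝ := fun n j => φ fun i => o n i + s n i * j i
  have hBg : ∀ n, B n =ᵐ[volume] fun z => stepFn (g n) (toGrid (o n) (s n) z) := hB
  let H : ℕ → L2 d := fun n =>
    ∑ α, weightMul (o n) (s n) α (translate (gridShift (s n) (vert α)) (B n))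
  have hH : ∀ n, H n =ᵐ[volume] fun z => hatSum (g n) (toGrid (o n) (s n) z) := fun n =>
    hatSum_eq_sum_weightMul (o n) (hs n) (g n) (B n) (hBg n)
  have hHΦ : Tendsto H atTop (𝓝 Φ) := by
    have h1 := tendsto_sum_weightMul_translate (o := o) hs0 (m := vert) hBΦ
    simp only [weightMul_sub, Finset.sum_sub_distrib, sum_weightMul] at h1
    exact tendsto_sub_nhds_zero_iff.1 h1
  -- `H n` and `B n` share the sampled coefficients, so linearity allows the norm comparison to be
  -- applied to the differences. Both approach `Φ`, which leaves only the density error.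
  have hWB : ∀ n, ‖W n - B n‖ ≤ 2 ^ d * ‖V n - H n‖ := by
    intro n
    obtain ⟨W₁, hW₁, hle⟩ := exists_stepFn_Lp (o n) (hs n) (w n - g n) (V n - H n) (by
      filter_upwards [hV n, hH n, Lp.coeFn_sub (V n) (H n)] with z h1 h2 h3
      rw [h3, Pi.sub_apply, h1, h2, hatSum_sub])
    have : W₁ = W n - B n := by
      refine Lp.ext ?_
      filter_upwards [hW n, hBg n, hW₁, Lp.coeFn_sub (W n) (B n)] with z h1 h2 h3 h4
      rw [h3, h4, Pi.sub_apply, h1, h2]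
      rfl
    rwa [← this]
  have hlim : Tendsto (fun n => 2 ^ d * ‖V n - H n‖ + ‖B n - Φ‖ + ‖Φ - V'‖) atTop
      (𝓝 (2 ^ d * ‖V' - Φ‖ + ‖Φ - Φ‖ + ‖Φ - V'‖)) :=
    (((h.sub hHΦ).norm.const_mul _).add (hBΦ.sub_const Φ).norm).add_const _
  have hlt : 2 ^ d * ‖V' - Φ‖ + ‖Φ - Φ‖ + ‖Φ - V'‖ < ε := by
    rw [sub_self, norm_zero, add_zero, norm_sub_rev V' Φ]
    rw [lt_div_iff₀ hD] at hdist
    nlinarith [norm_nonneg (Φ - V'), pow_pos (two_pos (α := ℝ)) d]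
  obtain ⟨N, hN⟩ := eventually_atTop.1 (hlim.eventually_lt_const hlt)
  refine ⟨N, fun n hn => lt_of_le_of_lt ?_ (hN n hn)⟩
  rw [dist_eq_norm]
  have htri : W n - V' = (W n - B n) + (B n - Φ) + (Φ - V') := by abel
  rw [htri]
  refine norm_add₃_le.trans ?_
  gcongr
  exact hWB n

end Sequences

/-! ### Weighted sums over grids -/

/-- All three factors are constant on the cells, so their product is a step function; it is
integrable as a product of two `L_2`-functions and a bounded one. -/
theorem grid_sum_eq_integral {o s : Pt d} (hs : ∀ i, 0 < s i) {v u q : Idx d → ℝ} {W Z : L2 d}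
    (hW : W =ᵐ[volume] fun z => stepFn v (toGrid o s z))
    (hZ : Z =ᵐ[volume] fun z => stepFn u (toGrid o s z)) {C : ℝ} (hq : ∀ j, |q j| ≤ C) :
    (Summable fun j => q j * v j * u j) ∧
      (∏ i, s i) * ∑' j, q j * v j * u j
        = ∫ z, W z * (stepFn q (toGrid o s z) * Z z) := by
  have hqm : Measurable fun z => stepFn q (toGrid o s z) :=
    (measurable_stepFn q).comp (continuous_toGrid o s).measurable
  have hmul := memLp_bdd_mul (C := C) hqm.aestronglyMeasurable
    (Eventually.of_forall fun _ => hq _) (Lp.memLp Z)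
  have hint : Integrable fun z => W z * (stepFn q (toGrid o s z) * Z z) :=
    (Lp.memLp W).integrable_mul hmul
  have hae : (fun z => W z * (stepFn q (toGrid o s z) * Z z)) =ᵐ[volume]
      fun z => stepFn (fun j => q j * v j * u j) (toGrid o s z) := by
    filter_upwards [hW, hZ] with z h1 h2
    rw [h1, h2]
    simp only [stepFn]
    ring
  have hsum := hasSum_of_integrable_stepFn_toGrid hs (hint.congr hae)
  refine ⟨hsum.summable, ?_⟩
  have hpos : 0 < ∏ i, s i := Finset.prod_pos fun i _ => hs i
  rw [hsum.tsum_eq, mul_inv_cancel_left₀ hpos.ne', integral_congr_ae hae]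

theorem summable_grid_of_hatSum {o s : Pt d} (hs : ∀ i, 0 < s i) {v u q : Idx d → ℝ} {V U : L2 d}
    (hV : V =ᵐ[volume] fun z => hatSum v (toGrid o s z))
    (hU : U =ᵐ[volume] fun z => hatSum u (toGrid o s z)) {C : ℝ} (hq : ∀ j, |q j| ≤ C) :
    Summable fun j => q j * v j * u j := by
  obtain ⟨W, hW, -⟩ := exists_stepFn_Lp o hs v V hV
  obtain ⟨Z, hZ, -⟩ := exists_stepFn_Lp o hs u U hU
  exact (grid_sum_eq_integral hs hW hZ hq).1

/-- Convergence of the weighted sums of products of the coefficients of a weakly and of a strongly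
convergent sequence of hat-function sums. -/
theorem tendsto_grid_sum {o s : ℕ → Pt d} (hs : ∀ n i, 0 < s n i) (hs0 : Tendsto s atTop (𝓝 0))
    {v u q : ℕ → Idx d → ℝ} {V U : ℕ → L2 d} {V' U' : L2 d}
    (hV : ∀ n, V n =ᵐ[volume] fun z => hatSum (v n) (toGrid (o n) (s n) z))
    (hU : ∀ n, U n =ᵐ[volume] fun z => hatSum (u n) (toGrid (o n) (s n) z))
    (hVV' : WeakTo V V') (hUU' : Tendsto U atTop (𝓝 U')) {q' : Pt d → ℝ} {C : ℝ}
    (hq : ∀ n j, |q n j| ≤ C)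
    (hqq' : ∀ᵐ z, Tendsto (fun n => q n (idxFloor (toGrid (o n) (s n) z))) atTop (𝓝 (q' z))) :
    Tendsto (fun n => (∏ i, s n i) * ∑' j, q n j * v n j * u n j) atTop
      (𝓝 (∫ z, q' z * V' z * U' z)) := by
  choose W hW hWV using fun n => exists_stepFn_Lp (o n) (hs n) (v n) (V n) (hV n)
  choose Z hZ hZU using fun n => exists_stepFn_Lp (o n) (hs n) (u n) (U n) (hU n)
  have hWt : WeakTo W V' := weakTo_stepFn hs hs0 hV hW hWV hVV'
  have hZt : Tendsto Z atTop (𝓝 U') := tendsto_stepFn hs hs0 hU hZ hUU'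
  have hqm : ∀ n, AEStronglyMeasurable (fun z => stepFn (q n) (toGrid (o n) (s n) z)) volume :=
    fun n => ((measurable_stepFn (q n)).comp
      (continuous_toGrid (o n) (s n)).measurable).aestronglyMeasurable
  have hqb : ∀ n z, |stepFn (q n) (toGrid (o n) (s n) z)| ≤ C := fun n z => hq n _
  have hq'm : AEStronglyMeasurable q' volume :=
    aestronglyMeasurable_of_tendsto_ae atTop hqm hqq'
  have hq'b : ∀ᵐ z, |q' z| ≤ C := by
    filter_upwards [hqq'] with z hz
    exact le_of_tendsto hz.abs (Eventually.of_forall fun n => hq n _)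
  have hmul : ∀ n (f : L2 d),
      MemLp (fun z => stepFn (q n) (toGrid (o n) (s n) z) * f z) 2 volume := fun n f =>
    memLp_bdd_mul (hqm n) (Eventually.of_forall (hqb n)) (Lp.memLp f)
  have hmul' : MemLp (fun z => q' z * U' z) 2 volume := memLp_bdd_mul hq'm hq'b (Lp.memLp U')
  -- The multiplier joins the strong factor. On the fixed `U'` dominated convergence applies, and
  -- the uniform bound `C` controls the change from `U'` to `Z n`.
  have hlim : Tendsto (fun n => (hmul n (Z n)).toLp _) atTop (𝓝 (hmul'.toLp _)) := by
    have h1 : Tendsto (fun n => (hmul n U').toLp _) atTop (𝓝 (hmul'.toLp _)) := by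
      refine tendsto_Lp_of_dominated ((Lp.memLp U').norm.const_mul C) (fun n => ?_) ?_
      · filter_upwards [(hmul n U').coeFn_toLp] with z hz
        rw [hz, abs_mul]
        exact mul_le_mul_of_nonneg_right (hqb n z) (abs_nonneg _)
      · filter_upwards [ae_all_iff.2 fun n => (hmul n U').coeFn_toLp, hmul'.coeFn_toLp, hqq']
          with z h1 h2 h3
        simp only [h1, h2]
        exact h3.mul_const _
    have h2 : Tendsto (fun n => (hmul n (Z n)).toLp _ - (hmul n U').toLp _) atTop (𝓝 0) := by
      refine squeeze_zero_norm (a := fun n => C * ‖Z n - U'‖) (fun n => ?_) ?_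
      · refine Lp.norm_le_mul_norm_of_ae_le_mul ?_
        filter_upwards [Lp.coeFn_sub ((hmul n (Z n)).toLp _) ((hmul n U').toLp _),
          (hmul n (Z n)).coeFn_toLp, (hmul n U').coeFn_toLp, Lp.coeFn_sub (Z n) U']
          with z h1 h2 h3 h4
        rw [h1, h4, Pi.sub_apply, Pi.sub_apply, h2, h3, ← mul_sub, norm_mul]
        exact mul_le_mul_of_nonneg_right (hqb n z) (norm_nonneg _)
      · simpa using (tendsto_iff_norm_sub_tendsto_zero.1 hZt).const_mul C
    simpa using h2.add h1
  have hfin := hWt.tendsto_inner hlim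
  have hL : inner ℝ V' (hmul'.toLp _) = ∫ z, q' z * V' z * U' z := by
    rw [inner_eq_integral]
    refine integral_congr_ae ?_
    filter_upwards [hmul'.coeFn_toLp] with z hz
    rw [hz]
    ring
  rw [hL] at hfin
  refine hfin.congr fun n => ?_
  rw [(grid_sum_eq_integral (hs n) (hW n) (hZ n) (hq n)).2, inner_eq_integral]
  refine integral_congr_ae ?_
  filter_upwards [(hmul n (Z n)).coeFn_toLp] with z hz
  rw [hz]

/-! ### Interpolants and their difference quotients -/

theorem step_pos (n : ℕ) : 0 < step n := by unfold step; positivity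

theorem tendsto_step : Tendsto step atTop (𝓝 0) :=
  tendsto_pow_atTop_nhds_zero_of_lt_one (by norm_num) (by norm_num)

/-- The steps of a subgrid with periods `r`. -/
def subStep (n : ℕ) (r : Fin d → ℕ) : Pt d := fun i => step n * r i

theorem subStep_pos (n : ℕ) {r : Fin d → ℕ} (hr : ∀ l, 0 < r l) (i : Fin d) :
    0 < subStep n r i :=
  mul_pos (step_pos n) (by exact_mod_cast hr i)

theorem tendsto_subStep (r : Fin d → ℕ) : Tendsto (fun n => subStep n r) atTop (𝓝 0) := by
  rw [tendsto_pi_nhds]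
  intro i
  simpa [subStep] using tendsto_step.mul_const (r i : ℝ)

theorem prod_subStep (n : ℕ) (r : Fin d → ℕ) :
    ∏ i, subStep n r i = step n ^ d * ∏ l, (r l : ℝ) := by
  simp [subStep, Finset.prod_mul_distrib]

theorem interp_eq_hatSum (n : ℕ) (ρ : Idx d) {r : Fin d → ℕ} (hr : ∀ l, 0 < r l)
    (u : Idx d → ℝ) (z : Pt d) :
    interp n ρ r u z
      = hatSum (fun j => u (subIdx ρ r j)) (toGrid (knot n ρ) (subStep n r) z) := by
  unfold interp hatSum
  refine tsum_congr fun j => ?_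
  unfold hatFn
  congr 1
  refine Finset.prod_congr rfl fun i _ => ?_
  congr 1
  have h1 := (step_pos n).ne'
  have h2 : (r i : ℝ) ≠ 0 := by exact_mod_cast (hr i).ne'
  simp only [toGrid, knot, subStep, subIdx]
  push_cast
  field_simp
  ring

theorem hatSum_add_int (w : Idx d → ℝ) (y : Pt d) (m : Idx d) :
    hatSum w (fun i => y i + m i) = hatSum (fun j => w (j + m)) y := by
  simp only [hatSum_eq_sum, weight_add_int]
  refine Finset.sum_congr rfl fun α _ => ?_
  congr 2
  funext i
  simp only [Pi.add_apply, idxFloor, Int.floor_add_intCast]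
  ring

theorem hatSum_const_mul (c : ℝ) (w : Idx d → ℝ) (y : Pt d) :
    hatSum (fun j => c * w j) y = c * hatSum w y := by
  simp only [hatSum_eq_sum, Finset.mul_sum]
  exact Finset.sum_congr rfl fun α _ => by ring

theorem translate_hatSum {o s : Pt d} (hs : ∀ i, 0 < s i) {w : Idx d → ℝ} {V : L2 d}
    (hV : V =ᵐ[volume] fun z => hatSum w (toGrid o s z)) (m : Idx d) :
    translate (gridShift s m) V
      =ᵐ[volume] fun z => hatSum (fun j => w (j + m)) (toGrid o s z) := by
  filter_upwards [coeFn_translate (gridShift s m) V, ae_add_right hV (gridShift s m)] with z h1 h2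
  rw [h1, h2, ← hatSum_add_int, ← toGrid_add o hs]
  rfl

theorem gridShift_single (s : Pt d) (i : Fin d) (m : ℤ) :
    gridShift s (Pi.single i m) = Pi.single i (s i * m) := by
  funext l
  by_cases h : l = i
  · subst h; simp [gridShift]
  · simp [gridShift, h]

/-- A step that is a multiple of the period `r i` maps the subgrid to itself, so translation merely
shifts the coefficients. -/
theorem diffL2_hatSum {n : ℕ} {ρ : Idx d} {r : Fin d → ℕ} (hr : ∀ l, 0 < r l) {vg : Idx d → ℝ}
    {V : L2 d} (hV : V =ᵐ[volume] interp n ρ r vg) (i : Fin d) {σ : ℤ} (m : ℤ)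
    (hσ : σ = r i * m) :
    diffL2 i (σ * step n) V =ᵐ[volume] fun z =>
      hatSum (fun j => diffQ n i σ vg (subIdx ρ r j)) (toGrid (knot n ρ) (subStep n r) z) := by
  have hV' : V =ᵐ[volume] fun z =>
      hatSum (fun j => vg (subIdx ρ r j)) (toGrid (knot n ρ) (subStep n r) z) :=
    hV.trans (Eventually.of_forall fun z => interp_eq_hatSum n ρ hr vg z)
  have ht := translate_hatSum (subStep_pos n hr) hV' (Pi.single i m)
  have hshift : gridShift (subStep n r) (Pi.single i m) = Pi.single i ((σ : ℝ) * step n) := by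
    rw [gridShift_single, hσ, subStep]
    push_cast
    congr 1
    ring
  rw [hshift] at ht
  have hidx : ∀ j : Idx d, subIdx ρ r (j + Pi.single i m) = subIdx ρ r j + Pi.single i σ := by
    intro j
    funext l
    by_cases h : l = i
    · subst h; simp [subIdx, hσ]; ring
    · simp [subIdx, h]
  have hfun : (fun j => diffQ n i σ vg (subIdx ρ r j)) = fun j =>
      ((σ : ℝ) * step n)⁻¹ * ((fun j => vg (subIdx ρ r (j + Pi.single i m)) : Idx d → ℝ)
        - fun j => vg (subIdx ρ r j)) j := by
    funext j
    rw [Pi.sub_apply, hidx, diffQ, div_eq_inv_mul]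
  filter_upwards [ht, hV', Lp.coeFn_smul ((σ : ℝ) * step n)⁻¹
      (translate (Pi.single i ((σ : ℝ) * step n)) V - V),
    Lp.coeFn_sub (translate (Pi.single i ((σ : ℝ) * step n)) V) V] with z h1 h2 h3 h4
  rw [diffL2, h3, Pi.smul_apply, h4, Pi.sub_apply, h1, h2, hfun, hatSum_const_mul, hatSum_sub,
    smul_eq_mul]

theorem tendsto_intCast_mul_step (σ : ℤ) :
    Tendsto (fun n => (σ : ℝ) * step n) atTop (𝓝 0) := by
  simpa using tendsto_step.const_mul (σ : ℝ)

theorem intCast_mul_step_ne_zero {σ : ℤ} (hσ : σ ≠ 0) (n : ℕ) : (σ : ℝ) * step n ≠ 0 :=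
  mul_ne_zero (by exact_mod_cast hσ) (step_pos n).ne'

theorem knot_subIdx_idxFloor (n : ℕ) (ρ : Idx d) (r : Fin d → ℕ) (z : Pt d) :
    knot n (subIdx ρ r (idxFloor (toGrid (knot n ρ) (subStep n r) z)))
      = corner (knot n ρ) (subStep n r) z := by
  funext i
  simp only [knot, subIdx, corner, subStep]
  push_cast
  ring

/-- Convergence of the Riemann-sum functionals on a family of subgrids. -/
theorem riemann_sum_consistency (p : Pt d → ℝ) (ξ : ℕ → Pt d → Pt d) (ω : ℝ) (r : Fin d → ℕ)
    (ρ : ℕ → Idx d) (i j : Fin d) (hp : BddUnifCont p) (hr : ∀ l, 0 < r l)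
    (hξ : ∀ n, 1 ≤ n → ∀ m : Idx d,
      ‖ξ n (knot n (subIdx (ρ n) r m)) - knot n (subIdx (ρ n) r m)‖ ≤ ω / n)
    (v' u' : W12 d) (v u : ℕ → W12 d) (vg ug : ℕ → Idx d → ℝ)
    (hv : ∀ n, W12fn (v n) =ᵐ[volume] interp n (ρ n) r (vg n))
    (hu : ∀ n, W12fn (u n) =ᵐ[volume] interp n (ρ n) r (ug n))
    (hvv' : WeaklyConverges v v') (huu' : Tendsto u atTop (𝓝 u')) :
    (∀ n, Summable fun m : Idx d =>
      riemannTerm p ξ r i j n (vg n) (ug n) (subIdx (ρ n) r m)) ∧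
    Tendsto (fun n => step n ^ d * (∏ l, (r l : ℝ)) *
        ∑' m : Idx d, riemannTerm p ξ r i j n (vg n) (ug n) (subIdx (ρ n) r m))
      atTop (𝓝 (∫ x, p x * W12grad v' i x * W12grad u' j x)) := by
  obtain ⟨hpc, C, hC⟩ := hp
  have hri : ∀ l, ((r l : ℤ)) ≠ 0 := fun l => by exact_mod_cast (hr l).ne'
  have hV := fun n => diffL2_hatSum hr (hv n) i (σ := r i) 1 (by simp)
  have hU := fun n => diffL2_hatSum hr (hu n) j (σ := r j) 1 (by simp)
  have hVw := hvv'.diffL2 i (intCast_mul_step_ne_zero (hri i)) (tendsto_intCast_mul_step (r i))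
  have hUs := tendsto_diffL2 huu' j (intCast_mul_step_ne_zero (hri j))
    (tendsto_intCast_mul_step (r j))
  refine ⟨fun n => summable_grid_of_hatSum
    (q := fun m => p (ξ n (knot n (subIdx (ρ n) r m))))
    (subStep_pos n hr) (hV n) (hU n) fun _ => hC _, ?_⟩
  have h := tendsto_grid_sum (fun n => subStep_pos n hr) (tendsto_subStep r)
    (q := fun n m => p (ξ n (knot n (subIdx (ρ n) r m)))) (q' := p) (C := C)
    hV hU hVw hUs (fun _ _ => hC _) (Eventually.of_forall fun z => ?_)
  · simp only [prod_subStep] at h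
    exact h
  · refine (hpc.continuous.tendsto z).comp ?_
    have h1 := tendsto_corner (o := fun n => knot n (ρ n)) (fun n => subStep_pos n hr)
      (tendsto_subStep r) z
    -- The sampling point is within `ω / n` of the corner, and the corner tends to `z`; continuity
    -- of `p` then gives the limit of the coefficients.
    have h2 : Tendsto (fun n => ξ n (corner (knot n (ρ n)) (subStep n r) z)
        - corner (knot n (ρ n)) (subStep n r) z) atTop (𝓝 0) := by
      refine squeeze_zero_norm' ?_ (tendsto_const_div_atTop_nhds_zero_nat ω)
      filter_upwards [eventually_ge_atTop 1] with n hn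
      have := hξ n hn (idxFloor (toGrid (knot n (ρ n)) (subStep n r) z))
      rwa [knot_subIdx_idxFloor] at this
    have h3 := h2.add h1
    simp only [sub_add_cancel, zero_add] at h3
    simpa only [knot_subIdx_idxFloor] using h3

/-! ### Local bilinear forms and their matrices -/

/-- Square-summable grid functions. -/
def SqSummable (v : Idx d → ℝ) : Prop := Summable fun k => v k ^ 2

theorem sqSummable_single (k : Idx d) : SqSummable (Pi.single k (1 : ℝ)) :=
  summable_of_ne_finset_zero (s := {k}) fun l hl => by
    rw [Pi.single_eq_of_ne (by simpa using hl), zero_pow two_ne_zero]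

theorem SqSummable.shift {v : Idx d → ℝ} (h : SqSummable v) (α : Idx d) :
    SqSummable fun k => v (k + α) :=
  (Equiv.addRight α).summable_iff (f := fun k => v k ^ 2) |>.2 h

theorem SqSummable.summable_mul {v u q : Idx d → ℝ} (hv : SqSummable v) (hu : SqSummable u)
    {C : ℝ} (hq : ∀ k, |q k| ≤ C) : Summable fun k => q k * v k * u k := by
  refine Summable.of_norm_bounded (g := fun k => C * (v k ^ 2 + u k ^ 2))
    ((Summable.add hv hu).mul_left C) fun k => ?_
  rw [mul_assoc, norm_mul, Real.norm_eq_abs, Real.norm_eq_abs]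
  refine mul_le_mul (hq k) ?_ (abs_nonneg _) ((abs_nonneg _).trans (hq k))
  rw [abs_le]
  constructor <;> nlinarith [sq_nonneg (v k + u k), sq_nonneg (v k - u k), sq_nonneg (v k),
    sq_nonneg (u k)]

/-- The matrix of a form that is given by its summands at the knots. -/
def formMatrix (B : (Idx d → ℝ) → (Idx d → ℝ) → Idx d → ℝ) : Matrix (Idx d) (Idx d) ℝ :=
  fun k l => ∑' x, B (Pi.single k 1) (Pi.single l 1) x

/-- The form with summands `B` is absolutely convergent on square-summable grid functions, and it
is represented there by its matrix. -/
def IsMatrixForm (B : (Idx d → ℝ) → (Idx d → ℝ) → Idx d → ℝ) : Prop :=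
  ∀ v u : Idx d → ℝ, SqSummable v → SqSummable u →
    Summable (B v u) ∧
    (∀ k, Summable fun l => formMatrix B k l * u l) ∧
    HasSum (fun k => v k * applyMatrix (formMatrix B) u k) (∑' x, B v u x)

theorem IsMatrixForm.add {B₁ B₂ : (Idx d → ℝ) → (Idx d → ℝ) → Idx d → ℝ}
    (h₁ : IsMatrixForm B₁) (h₂ : IsMatrixForm B₂) :
    IsMatrixForm fun v u x => B₁ v u x + B₂ v u x := by
  intro v u hv hu
  obtain ⟨a₁, b₁, c₁⟩ := h₁ v u hv hu
  obtain ⟨a₂, b₂, c₂⟩ := h₂ v u hv hu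
  -- Coordinate columns are square-summable, so the absolute convergence of both forms also permits
  -- splitting each matrix entry.
  have hM : ∀ k l, formMatrix (fun v u x => B₁ v u x + B₂ v u x) k l
      = formMatrix B₁ k l + formMatrix B₂ k l := fun k l =>
    (h₁ _ _ (sqSummable_single k) (sqSummable_single l)).1.tsum_add
      (h₂ _ _ (sqSummable_single k) (sqSummable_single l)).1
  have hA : ∀ k, applyMatrix (formMatrix fun v u x => B₁ v u x + B₂ v u x) u k
      = applyMatrix (formMatrix B₁) u k + applyMatrix (formMatrix B₂) u k := fun k => by
    simp only [applyMatrix, hM, add_mul]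
    exact (b₁ k).tsum_add (b₂ k)
  refine ⟨a₁.add a₂, fun k => ?_, ?_⟩
  · simp only [hM, add_mul]
    exact (b₁ k).add (b₂ k)
  · simp only [hA, mul_add]
    rw [a₁.tsum_add a₂]
    exact c₁.add c₂

theorem isMatrixForm_zero : IsMatrixForm fun (_ _ : Idx d → ℝ) (_ : Idx d) => (0 : ℝ) := by
  intro v u _ _
  have hM : formMatrix (fun (_ _ : Idx d → ℝ) (_ : Idx d) => (0 : ℝ)) = 0 := by
    funext k l; simp [formMatrix]
  refine ⟨summable_zero, fun k => ?_, ?_⟩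
  · simp [hM, summable_zero]
  · simp [hM, applyMatrix, hasSum_zero]

theorem IsMatrixForm.sum {ι : Type*} (t : Finset ι)
    {B : ι → (Idx d → ℝ) → (Idx d → ℝ) → Idx d → ℝ} (h : ∀ i ∈ t, IsMatrixForm (B i)) :
    IsMatrixForm fun v u x => ∑ i ∈ t, B i v u x := by
  classical
  induction t using Finset.induction_on with
  | empty => simpa using isMatrixForm_zero
  | insert i t hi ih =>
    simp only [Finset.sum_insert hi]
    exact (h i (Finset.mem_insert_self i t)).add
      (ih fun j hj => h j (Finset.mem_insert_of_mem hj))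

/-- Each row has a single possibly nonzero entry, in column `k - α + β`. The matrix series is the
original series after the substitution `k = x + α`. -/
theorem isMatrixForm_shift {q : Idx d → ℝ} {C : ℝ} (hq : ∀ k, |q k| ≤ C) (α β : Idx d) :
    IsMatrixForm fun v u x => q x * v (x + α) * u (x + β) := by
  intro v u hv hu
  have hsum : Summable fun x => q x * v (x + α) * u (x + β) :=
    (hv.shift α).summable_mul (hu.shift β) hq
  have hM : ∀ k l, formMatrix (fun v u x => q x * v (x + α) * u (x + β)) k l
      = if l = k - α + β then q (k - α) else 0 := by
    intro k l
    rw [formMatrix, tsum_eq_single (k - α)]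
    · rw [sub_add_cancel, Pi.single_eq_same, mul_one]
      by_cases h : l = k - α + β
      · rw [if_pos h, h, Pi.single_eq_same, mul_one]
      · rw [if_neg h, Pi.single_eq_of_ne (Ne.symm h), mul_zero]
    · intro x hx
      rw [Pi.single_eq_of_ne (fun h => hx (eq_sub_of_add_eq h)), mul_zero, zero_mul]
  have hrow : ∀ k l, l ≠ k - α + β →
      formMatrix (fun v u x => q x * v (x + α) * u (x + β)) k l * u l = 0 := fun k l hl => by
    rw [hM, if_neg hl, zero_mul]
  refine ⟨hsum, fun k => ?_, ?_⟩
  · exact summable_of_ne_finset_zero (s := {k - α + β}) fun l hl => hrow k l (by simpa using hl)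
  · have hA : ∀ k, applyMatrix (formMatrix fun v u x => q x * v (x + α) * u (x + β)) u k
        = q (k - α) * u (k - α + β) := fun k => by
      rw [applyMatrix, tsum_eq_single _ (hrow k), hM, if_pos rfl]
    simp only [hA]
    rw [← (Equiv.addRight α).hasSum_iff]
    convert hsum.hasSum using 1
    funext x
    simp only [Function.comp_apply, Equiv.coe_addRight, add_sub_cancel_right]
    ring

/-- Finite linear combinations of shifts of grid functions. -/
def IsShiftSum (T : (Idx d → ℝ) → Idx d → ℝ) : Prop :=
  ∃ (m : ℕ) (c : Fin m → ℝ) (α : Fin m → Idx d), ∀ w x, T w x = ∑ i, c i * w (x + α i)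

theorem isShiftSum_shift (α : Idx d) : IsShiftSum fun w x => w (x + α) :=
  ⟨1, fun _ => 1, fun _ => α, fun w x => by simp⟩

theorem isShiftSum_id : IsShiftSum fun (w : Idx d → ℝ) x => w x :=
  ⟨1, fun _ => 1, fun _ => 0, fun w x => by simp⟩

theorem isShiftSum_diffQ (n : ℕ) (i : Fin d) (σ : ℤ) : IsShiftSum (diffQ n i σ) :=
  ⟨2, ![(σ * step n)⁻¹, -(σ * step n)⁻¹], ![Pi.single i σ, 0], fun w x => by
    simp [diffQ]; ring⟩

theorem isMatrixForm_of_isShiftSum {q : Idx d → ℝ} {C : ℝ} (hq : ∀ k, |q k| ≤ C)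
    {T₁ T₂ : (Idx d → ℝ) → Idx d → ℝ} (h₁ : IsShiftSum T₁) (h₂ : IsShiftSum T₂) :
    IsMatrixForm fun v u x => q x * T₁ v x * T₂ u x := by
  obtain ⟨m₁, c₁, α, e₁⟩ := h₁
  obtain ⟨m₂, c₂, β, e₂⟩ := h₂
  have heq : (fun v u x => q x * T₁ v x * T₂ u x) = fun v u x =>
      ∑ i : Fin m₁, ∑ j : Fin m₂, (c₁ i * c₂ j * q x) * v (x + α i) * u (x + β j) := by
    funext v u x
    rw [e₁, e₂, mul_assoc, Finset.sum_mul_sum, Finset.mul_sum]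
    refine Finset.sum_congr rfl fun i _ => ?_
    rw [Finset.mul_sum]
    exact Finset.sum_congr rfl fun j _ => by ring
  rw [heq]
  refine IsMatrixForm.sum _ fun i _ => IsMatrixForm.sum _ fun j _ =>
    isMatrixForm_shift (C := |c₁ i * c₂ j| * C) (fun k => ?_) _ _
  rw [abs_mul]
  exact mul_le_mul_of_nonneg_left (hq k) (abs_nonneg _)

/-! ### Consistent families of forms -/

/-- The forms with summands `B n`, scaled by `h^d`, are represented by their matrices and converge
to `L` along the grid functions `vg`, `ug`. -/
def Consistent (vg ug : ℕ → Idx d → ℝ) (B : ℕ → (Idx d → ℝ) → (Idx d → ℝ) → Idx d → ℝ)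
    (L : ℝ) : Prop :=
  (∀ n, IsMatrixForm (B n)) ∧ (∀ n, Summable (B n (vg n) (ug n))) ∧
    Tendsto (fun n => step n ^ d * ∑' x, B n (vg n) (ug n) x) atTop (𝓝 L)

section Consistent

variable {vg ug : ℕ → Idx d → ℝ}

theorem Consistent.add {B₁ B₂ : ℕ → (Idx d → ℝ) → (Idx d → ℝ) → Idx d → ℝ} {L₁ L₂ : ℝ}
    (h₁ : Consistent vg ug B₁ L₁) (h₂ : Consistent vg ug B₂ L₂) :
    Consistent vg ug (fun n v u x => B₁ n v u x + B₂ n v u x) (L₁ + L₂) := by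
  refine ⟨fun n => (h₁.1 n).add (h₂.1 n), fun n => (h₁.2.1 n).add (h₂.2.1 n), ?_⟩
  refine (h₁.2.2.add h₂.2.2).congr fun n => ?_
  rw [(h₁.2.1 n).tsum_add (h₂.2.1 n), mul_add]

theorem consistent_zero : Consistent vg ug (fun _ _ _ _ => 0) 0 :=
  ⟨fun _ => isMatrixForm_zero, fun _ => summable_zero, by simp⟩

theorem Consistent.sum {ι : Type*} (t : Finset ι)
    {B : ι → ℕ → (Idx d → ℝ) → (Idx d → ℝ) → Idx d → ℝ} {L : ι → ℝ}
    (h : ∀ i ∈ t, Consistent vg ug (B i) (L i)) :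
    Consistent vg ug (fun n v u x => ∑ i ∈ t, B i n v u x) (∑ i ∈ t, L i) := by
  classical
  induction t using Finset.induction_on with
  | empty => simpa using consistent_zero
  | insert i t hi ih =>
    simp only [Finset.sum_insert hi]
    exact (h i (Finset.mem_insert_self i t)).add
      (ih fun j hj => h j (Finset.mem_insert_of_mem hj))

theorem Consistent.congr {B B' : ℕ → (Idx d → ℝ) → (Idx d → ℝ) → Idx d → ℝ} {L L' : ℝ}
    (h : Consistent vg ug B L) (hB : ∀ n v u x, B' n v u x = B n v u x) (hL : L' = L) :
    Consistent vg ug B' L' := by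
  have : B' = B := by
    funext n v u x; exact hB n v u x
  rw [this, hL]
  exact h

end Consistent

/-! ### Convergent grid functions on the full grid -/

/-- The index of the cell of `G_n` that contains `z`. -/
def cellIdx (n : ℕ) (z : Pt d) : Idx d :=
  idxFloor (toGrid (knot n fun _ => 0) (subStep n fun _ => 1) z)

theorem subIdx_zero_one (j : Idx d) : subIdx (fun _ => 0) (fun _ => 1) j = j := by
  funext i; simp [subIdx]

theorem tendsto_knot_cellIdx (z : Pt d) :
    Tendsto (fun n => knot n (cellIdx n z)) atTop (𝓝 z) := by
  have h := tendsto_corner (o := fun n => knot n fun _ => 0)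
    (fun n => subStep_pos n (r := fun _ : Fin d => 1) fun _ => one_pos)
    (tendsto_subStep fun _ : Fin d => 1) z
  refine h.congr fun n => ?_
  rw [← knot_subIdx_idxFloor, subIdx_zero_one, cellIdx]

theorem tendsto_knot_add_cellIdx (z e : Pt d) :
    Tendsto (fun n => knot n (cellIdx n z) + (step n / 2) • e) atTop (𝓝 z) := by
  have h1 : Tendsto (fun n => (step n / 2) • e) atTop (𝓝 0) := by
    simpa using (tendsto_step.div_const 2).smul_const e
  simpa using (tendsto_knot_cellIdx z).add h1

/-- Grid functions whose interpolants converge weakly, respectively strongly, in `W_2^1`. -/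
structure GridConvergence (vg ug : ℕ → Idx d → ℝ) (v' u' : W12 d) (v u : ℕ → W12 d) : Prop where
  left : ∀ n, W12fn (v n) =ᵐ[volume] interpFull n (vg n)
  right : ∀ n, W12fn (u n) =ᵐ[volume] interpFull n (ug n)
  weak : WeaklyConverges v v'
  strong : Tendsto u atTop (𝓝 u')

section GridConvergence

theorem prod_subStep_one (n : ℕ) : ∏ i, subStep n (fun _ : Fin d => 1) i = step n ^ d := by
  simp [prod_subStep]

theorem interpFull_ae_hatSum {n : ℕ} {wg : Idx d → ℝ} {w : W12 d}
    (h : W12fn w =ᵐ[volume] interpFull n wg) :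
    (w : L2Tuple d) none =ᵐ[volume] fun z =>
      hatSum wg (toGrid (knot n fun _ => 0) (subStep n fun _ => 1) z) := by
  refine h.trans (Eventually.of_forall fun z => ?_)
  simp only [interpFull, interp_eq_hatSum n _ (r := fun _ : Fin d => 1) (fun _ => one_pos),
    subIdx_zero_one]

theorem diffL2_interpFull {n : ℕ} {wg : Idx d → ℝ} {w : W12 d}
    (h : W12fn w =ᵐ[volume] interpFull n wg) (i : Fin d) (σ : ℤ) :
    diffL2 i (σ * step n) ((w : L2Tuple d) none) =ᵐ[volume] fun z =>
      hatSum (diffQ n i σ wg) (toGrid (knot n fun _ => 0) (subStep n fun _ => 1) z) := by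
  have := diffL2_hatSum (r := fun _ : Fin d => 1) (fun _ => one_pos) h i (σ := σ) σ (by simp)
  simpa only [subIdx_zero_one] using this

/-- The product estimate for grid sums is applied with both coefficient families equal to `wg` and
unit weight. -/
theorem sqSummable_of_interpFull {n : ℕ} {wg : Idx d → ℝ} {w : W12 d}
    (h : W12fn w =ᵐ[volume] interpFull n wg) : SqSummable wg := by
  have := summable_grid_of_hatSum (subStep_pos n (r := fun _ : Fin d => 1) fun _ => one_pos)
    (q := fun _ => 1) (C := 1) (interpFull_ae_hatSum h) (interpFull_ae_hatSum h) (by simp)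
  simpa [SqSummable, pow_two] using this

variable {vg ug : ℕ → Idx d → ℝ} {v' u' : W12 d} {v u : ℕ → W12 d}

/-- The shift-sum structure serves only the matrix representation; the hat-function sums serve only
the summability and the limit. -/
theorem consistent_of_hatSum {T₁ T₂ : ℕ → (Idx d → ℝ) → Idx d → ℝ}
    (h₁ : ∀ n, IsShiftSum (T₁ n)) (h₂ : ∀ n, IsShiftSum (T₂ n)) {V U : ℕ → L2 d} {V' U' : L2 d}
    (hV : ∀ n, V n =ᵐ[volume] fun z =>
      hatSum (T₁ n (vg n)) (toGrid (knot n fun _ => 0) (subStep n fun _ => 1) z))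
    (hU : ∀ n, U n =ᵐ[volume] fun z =>
      hatSum (T₂ n (ug n)) (toGrid (knot n fun _ => 0) (subStep n fun _ => 1) z))
    (hVV' : WeakTo V V') (hUU' : Tendsto U atTop (𝓝 U')) {q : ℕ → Idx d → ℝ} {q' : Pt d → ℝ}
    {C : ℝ} (hq : ∀ n j, |q n j| ≤ C)
    (hqq' : ∀ᵐ z, Tendsto (fun n => q n (cellIdx n z)) atTop (𝓝 (q' z))) :
    Consistent vg ug (fun n v u x => q n x * T₁ n v x * T₂ n u x)
      (∫ z, q' z * V' z * U' z) := by
  refine ⟨fun n => isMatrixForm_of_isShiftSum (hq n) (h₁ n) (h₂ n), fun n => ?_, ?_⟩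
  · exact summable_grid_of_hatSum (subStep_pos n (r := fun _ : Fin d => 1) fun _ => one_pos)
      (hV n) (hU n) (hq n)
  · have := tendsto_grid_sum (fun n => subStep_pos n (r := fun _ : Fin d => 1) fun _ => one_pos)
      (tendsto_subStep fun _ : Fin d => 1) hV hU hVV' hUU' hq hqq'
    simpa only [prod_subStep_one] using this

namespace GridConvergence

variable {q : ℕ → Idx d → ℝ} {q' : Pt d → ℝ} {C : ℝ}

theorem consistent_grad_grad (H : GridConvergence vg ug v' u' v u)
    (hq : ∀ n j, |q n j| ≤ C)
    (hqq' : ∀ᵐ z, Tendsto (fun n => q n (cellIdx n z)) atTop (𝓝 (q' z))) (i j : Fin d) {σ τ : ℤ}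
    (hσ : σ ≠ 0) (hτ : τ ≠ 0) :
    Consistent vg ug (fun n v u x => q n x * diffQ n i σ v x * diffQ n j τ u x)
      (∫ z, q' z * W12grad v' i z * W12grad u' j z) :=
  consistent_of_hatSum (fun n => isShiftSum_diffQ n i σ) (fun n => isShiftSum_diffQ n j τ)
    (fun n => diffL2_interpFull (H.left n) i σ) (fun n => diffL2_interpFull (H.right n) j τ)
    (H.weak.diffL2 i (intCast_mul_step_ne_zero hσ) (tendsto_intCast_mul_step σ))
    (tendsto_diffL2 H.strong j (intCast_mul_step_ne_zero hτ) (tendsto_intCast_mul_step τ)) hq hqq'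

/-- A shift by a fixed multi-index is a translation by a vector tending to zero, so it does not
change the strong limit. The upwind choice of endpoint is thus invisible in the limit. -/
theorem consistent_grad_shift (H : GridConvergence vg ug v' u' v u)
    (hq : ∀ n j, |q n j| ≤ C)
    (hqq' : ∀ᵐ z, Tendsto (fun n => q n (cellIdx n z)) atTop (𝓝 (q' z))) (i : Fin d)
    (α : Idx d) :
    Consistent vg ug (fun n v u x => q n x * diffQ n i 1 v x * u (x + α))
      (∫ z, q' z * W12grad v' i z * W12fn u' z) :=
  consistent_of_hatSum (fun n => isShiftSum_diffQ n i 1) (fun _ => isShiftSum_shift α)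
    (fun n => diffL2_interpFull (H.left n) i 1)
    (fun n => translate_hatSum (subStep_pos n fun _ => one_pos)
      (interpFull_ae_hatSum (H.right n)) α)
    (H.weak.diffL2 i (intCast_mul_step_ne_zero one_ne_zero) (tendsto_intCast_mul_step 1))
    (tendsto_translate (tendsto_component H.strong none)
      (tendsto_gridShift (tendsto_subStep fun _ : Fin d => 1) α)) hq hqq'

theorem consistent_fn_fn (H : GridConvergence vg ug v' u' v u)
    (hq : ∀ n j, |q n j| ≤ C)
    (hqq' : ∀ᵐ z, Tendsto (fun n => q n (cellIdx n z)) atTop (𝓝 (q' z))) :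
    Consistent vg ug (fun n v u x => q n x * v x * u x)
      (∫ z, q' z * W12fn v' z * W12fn u' z) :=
  consistent_of_hatSum (fun _ => isShiftSum_id) (fun _ => isShiftSum_id)
    (fun n => interpFull_ae_hatSum (H.left n)) (fun n => interpFull_ae_hatSum (H.right n))
    (H.weak.component none) (tendsto_component H.strong none) hq hqq'

end GridConvergence

end GridConvergence

/-! ### The extended schemes -/

/-- The part of `∫ f ∂_i v ∂_j u` that comes from the region `E`. -/
def regionForm (E : Set (Pt d)) (f : Pt d → ℝ) (v u : W12 d) (i j : Fin d) : ℝ :=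
  ∫ z, E.indicator (fun _ => 1) z * f z * W12grad v i z * W12grad u j z

theorem tendsto_indicator_of_notMem_frontier {E : Set (Pt d)} {z : Pt d} (hz : z ∉ frontier E)
    {y : ℕ → Pt d} (hy : Tendsto y atTop (𝓝 z)) :
    Tendsto (fun n => E.indicator (fun _ => (1 : ℝ)) (y n)) atTop
      (𝓝 (E.indicator (fun _ => 1) z)) := by
  refine tendsto_const_nhds.congr' ?_
  by_cases h : z ∈ closure E
  · have hi : z ∈ interior E := by
      by_contra hcon
      exact hz ⟨h, hcon⟩
    filter_upwards [hy (mem_interior_iff_mem_nhds.1 hi)] with n hn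
    rw [Set.indicator_of_mem (interior_subset hi), Set.indicator_of_mem (show y n ∈ E from hn)]
  · filter_upwards [hy (isClosed_closure.isOpen_compl.mem_nhds h)] with n hn
    rw [Set.indicator_of_notMem fun hE => h (subset_closure hE),
      Set.indicator_of_notMem fun hE => hn (subset_closure hE)]

section Region

variable {vg ug : ℕ → Idx d → ℝ} {v' u' : W12 d} {v u : ℕ → W12 d}

/-- The sampled indicator converges at every point off the frontier of `E`, hence almost everywhere,
so it can be treated as part of the bounded coefficient. -/
theorem GridConvergence.consistent_region (H : GridConvergence vg ug v' u' v u) {E : Set (Pt d)}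
    (hE : volume (frontier E) = 0) {f : Pt d → ℝ} (hf : BddUnifCont f) (κ : ℝ) (e : Pt d)
    (i j : Fin d) {σ τ : ℤ} (hσ : σ ≠ 0) (hτ : τ ≠ 0) :
    Consistent vg ug (fun n v u x => E.indicator (fun _ => 1) (knot n x) *
        (κ * f (knot n x + (step n / 2) • e)) * diffQ n i σ v x * diffQ n j τ u x)
      (κ * regionForm E f v' u' i j) := by
  obtain ⟨hfc, C, hC⟩ := hf
  have h := H.consistent_grad_grad (C := |κ| * C) (q' := fun z =>
      E.indicator (fun _ => 1) z * (κ * f z))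
    (q := fun n x => E.indicator (fun _ => 1) (knot n x) * (κ * f (knot n x + (step n / 2) • e)))
    (fun n k => ?_) ?_ i j hσ hτ
  · refine h.congr (fun _ _ _ _ => rfl) ?_
    rw [regionForm, ← integral_const_mul]
    exact integral_congr_ae (Eventually.of_forall fun z => by ring)
  · rw [abs_mul, abs_mul]
    have h1 : |E.indicator (fun _ => (1 : ℝ)) (knot n k)| ≤ 1 := by
      by_cases hk : knot n k ∈ E <;> simp [hk]
    have h2 := mul_le_mul_of_nonneg_left (hC (knot n k + (step n / 2) • e)) (abs_nonneg κ)
    calc _ ≤ 1 * (|κ| * |f (knot n k + (step n / 2) • e)|) :=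
          mul_le_mul_of_nonneg_right h1 (by positivity)
      _ ≤ _ := by rwa [one_mul]
  · have hae : ∀ᵐ z, z ∉ frontier E := measure_eq_zero_iff_ae_notMem.1 hE
    filter_upwards [hae] with z hz
    refine (tendsto_indicator_of_notMem_frontier hz (tendsto_knot_cellIdx z)).mul ?_
    exact ((hfc.continuous.tendsto z).comp (tendsto_knot_add_cellIdx z e)).const_mul κ

theorem Stencil.ε_ne_zero (t : Stencil) : t.ε ≠ 0 := by
  unfold Stencil.ε; split_ifs <;> norm_num

/-- The extended scheme with a fixed stencil, restricted to a region. -/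
theorem GridConvergence.consistent_region_planeTerm (H : GridConvergence vg ug v' u' v u)
    {E : Set (Pt d)} (hE : volume (frontier E) = 0) {a : Fin d → Fin d → Pt d → ℝ}
    (ha : ∀ i j, BddUnifCont (a i j)) (i j : Fin d) (t : Stencil) :
    Consistent vg ug
      (fun n v u x => E.indicator (fun _ => 1) (knot n x) * planeTerm a n i j t v u x)
      (((d : ℝ) - 1)⁻¹ * (regionForm E (a i i) v' u' i i + regionForm E (a j j) v' u' j j)
        + (regionForm E (a i j) v' u' i j + regionForm E (a j i) v' u' j i)) := by
  have hε := t.ε_ne_zero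
  have hr : (t.r₁ : ℤ) ≠ 0 := by exact_mod_cast t.pos₁.ne'
  have hs : t.ε * (t.r₂ : ℤ) ≠ 0 := mul_ne_zero hε (by exact_mod_cast t.pos₂.ne')
  let y : Pt d := Pi.single i ((1 : ℤ) : ℝ) + Pi.single j (t.ε : ℝ)
  let yr : Pt d := Pi.single i (((t.r₁ : ℕ) : ℤ) : ℝ) + Pi.single j ((t.ε * (t.r₂ : ℤ) : ℤ) : ℝ)
  -- Each correction term occurs once with the short step and weight `κ` and once with the long step
  -- and weight `-κ`. The limit does not depend on the step, so the two contributions cancel.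
  let κ₁ : ℝ := t.ε * ((t.r₁ : ℝ) / t.r₂)
  let κ₂ : ℝ := t.ε * ((t.r₂ : ℝ) / t.r₁)
  have hsum :=
    (((H.consistent_region hE (ha i i) ((d : ℝ) - 1)⁻¹ y i i one_ne_zero one_ne_zero).add
      (H.consistent_region hE (ha j j) ((d : ℝ) - 1)⁻¹ y j j hε hε)).add
    ((H.consistent_region hE (ha i j) 1 yr i j hr hs).add
      (H.consistent_region hE (ha j i) 1 yr j i hs hr))).add
    (((H.consistent_region hE (ha i j) κ₁ yr i i one_ne_zero one_ne_zero).add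
      (H.consistent_region hE (ha i j) (-κ₁) yr i i hr hr)).add
    ((H.consistent_region hE (ha j i) κ₂ yr j j hε hε).add
      (H.consistent_region hE (ha j i) (-κ₂) yr j j hs hs)))
  refine hsum.congr (fun n v u x => ?_) (by ring)
  simp only [planeTerm, samplePt, y, yr, κ₁, κ₂]
  ring

theorem integrable_mul_grad {f : Pt d → ℝ} (hf : BddUnifCont f) (v u : W12 d) (i j : Fin d) :
    Integrable fun z => f z * W12grad v i z * W12grad u j z := by
  obtain ⟨hfc, C, hC⟩ := hf
  exact (memLp_bdd_mul hfc.continuous.aestronglyMeasurable (Eventually.of_forall hC)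
    (Lp.memLp ((v : L2Tuple d) (some i)))).integrable_mul (Lp.memLp ((u : L2Tuple d) (some j)))

/-- The regions on which the stencil is constant partition space, and there are finitely many of
them. A null frontier makes each region null measurable, which justifies splitting the integral. -/
theorem sum_regionForm {s : Pt d → Stencil} (hfin : (Set.range s).Finite)
    (hs : ∀ t, volume (frontier (s ⁻¹' {t})) = 0) {f : Pt d → ℝ} (hf : BddUnifCont f)
    (v u : W12 d) (i j : Fin d) :
    ∑ t ∈ hfin.toFinset, regionForm (s ⁻¹' {t}) f v u i j
      = ∫ z, f z * W12grad v i z * W12grad u j z := by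
  classical
  unfold regionForm
  rw [← integral_finsetSum]
  · refine integral_congr_ae (Eventually.of_forall fun z => ?_)
    change ∑ t ∈ hfin.toFinset, _ = _
    rw [Finset.sum_eq_single_of_mem (s z) (by simp)]
    · simp
    · intro t _ ht
      rw [Set.indicator_of_notMem (show z ∉ s ⁻¹' {t} from fun h => ht h.symm)]
      simp
  · intro t _
    have hE : NullMeasurableSet (s ⁻¹' {t}) volume := nullMeasurableSet_of_null_frontier (hs t)
    refine ((integrable_mul_grad hf v u i j).indicator₀ hE).congr
      (Eventually.of_forall fun z => ?_)
    by_cases hz : z ∈ s ⁻¹' {t}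
    · simp only [Set.indicator_of_mem hz, one_mul]
    · simp only [Set.indicator_of_notMem hz, zero_mul]

/-- At each knot exactly one region contributes. Summing over the finitely many stencils reduces
variable difference steps to fixed ones. -/
theorem GridConvergence.consistent_planeTerm (H : GridConvergence vg ug v' u' v u)
    {a : Fin d → Fin d → Pt d → ℝ} (ha : ∀ i j, BddUnifCont (a i j)) (i j : Fin d)
    {s : Pt d → Stencil} (hfin : (Set.range s).Finite)
    (hs : ∀ t, volume (frontier (s ⁻¹' {t})) = 0) :
    Consistent vg ug (fun n v u x => planeTerm a n i j (s (knot n x)) v u x)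
      (((d : ℝ) - 1)⁻¹ * ((∫ z, a i i z * W12grad v' i z * W12grad u' i z)
          + ∫ z, a j j z * W12grad v' j z * W12grad u' j z)
        + ((∫ z, a i j z * W12grad v' i z * W12grad u' j z)
          + ∫ z, a j i z * W12grad v' j z * W12grad u' i z)) := by
  refine (Consistent.sum hfin.toFinset fun t _ =>
    H.consistent_region_planeTerm (hs t) ha i j t).congr (fun n v u x => ?_) ?_
  · rw [Finset.sum_eq_single_of_mem (s (knot n x)) (by simp)]
    · simp
    · intro t _ ht
      rw [Set.indicator_of_notMem (show knot n x ∉ s ⁻¹' {t} from fun h => ht h.symm), zero_mul]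
  · simp only [Finset.sum_add_distrib, ← Finset.mul_sum, sum_regionForm hfin hs (ha _ _)]

/-! ### The upwind term and the whole form -/

theorem consistent_sampled (H : GridConvergence vg ug v' u' v u) {g : Pt d → ℝ}
    (hg : Continuous g) {C : ℝ} (hC : ∀ x, |g x| ≤ C) (e : Pt d) (i : Fin d) (α : Idx d) :
    Consistent vg ug
      (fun n v u x => g (knot n x + (step n / 2) • e) * diffQ n i 1 v x * u (x + α))
      (∫ z, g z * W12grad v' i z * W12fn u' z) :=
  H.consistent_grad_shift (q := fun n x => g (knot n x + (step n / 2) • e)) (fun _ _ => hC _)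
    (Eventually.of_forall fun z => (hg.tendsto z).comp (tendsto_knot_add_cellIdx z e)) i α

/-- The positive and negative parts of `b i` are continuous and bounded, so they can be passed to
the limit separately; the values of `u` at the two endpoints then coincide and the parts recombine.
-/
theorem GridConvergence.consistent_upwindTerm (H : GridConvergence vg ug v' u' v u)
    {b : Fin d → Pt d → ℝ} (hb : ∀ i, BddUnifCont (b i)) :
    Consistent vg ug (fun n v u x => upwindTerm b n v u x)
      (-∑ i, ∫ z, b i z * W12grad v' i z * W12fn u' z) := by
  have hi : ∀ i, Consistent vg ug
      (fun n v u x => -(max (b i (knot n x + (step n / 2) • Pi.single i (1 : ℝ))) 0)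
          * diffQ n i 1 v x * u (x + 0)
        + max (-b i (knot n x + (step n / 2) • Pi.single i (1 : ℝ))) 0
          * diffQ n i 1 v x * u (x + Pi.single i 1))
      (-∫ z, b i z * W12grad v' i z * W12fn u' z) := by
    intro i
    obtain ⟨hc, C, hC⟩ := hb i
    have hC0 : ∀ x, 0 ≤ C := fun x => (abs_nonneg _).trans (hC x)
    have hb1 : ∀ x, |-(max (b i x) 0)| ≤ C := fun x => by
      rw [abs_neg, abs_of_nonneg (le_max_right _ _)]
      exact max_le ((le_abs_self _).trans (hC x)) (hC0 x)
    have hb2 : ∀ x, |max (-b i x) 0| ≤ C := fun x => by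
      rw [abs_of_nonneg (le_max_right _ _)]
      exact max_le ((neg_le_abs _).trans (hC x)) (hC0 x)
    have c1 : Continuous fun x => -(max (b i x) 0) := (hc.continuous.max continuous_const).neg
    have c2 : Continuous fun x => max (-b i x) 0 := hc.continuous.neg.max continuous_const
    have hint : ∀ g : Pt d → ℝ, Continuous g → (∀ x, |g x| ≤ C) →
        Integrable fun z => g z * W12grad v' i z * W12fn u' z := fun g hg hgC =>
      (memLp_bdd_mul hg.aestronglyMeasurable (Eventually.of_forall hgC)
        (Lp.memLp ((v' : L2Tuple d) (some i)))).integrable_mul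
        (Lp.memLp ((u' : L2Tuple d) none))
    refine ((consistent_sampled H c1 hb1 (Pi.single i 1) i 0).add
      (consistent_sampled H c2 hb2 (Pi.single i 1) i (Pi.single i 1))).congr
      (fun _ _ _ _ => rfl) ?_
    rw [← integral_add (hint _ c1 hb1) (hint _ c2 hb2), ← integral_neg]
    refine integral_congr_ae (Eventually.of_forall fun z => ?_)
    have hsplit : b i z = max (b i z) 0 - max (-b i z) 0 := by
      rcases le_total 0 (b i z) with h | h
      · rw [max_eq_left h, max_eq_right (by linarith), sub_zero]
      · rw [max_eq_right h, max_eq_left (by linarith), zero_sub, neg_neg]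
    change -(b i z * _ * _) = _
    nth_rewrite 1 [hsplit]
    ring
  refine (Consistent.sum Finset.univ fun i _ => hi i).congr (fun n v u x => ?_)
    (Finset.sum_neg_distrib _).symm
  rw [upwindTerm, ← Finset.sum_neg_distrib]
  refine Finset.sum_congr rfl fun i _ => ?_
  rw [add_zero]
  ring

theorem GridConvergence.consistent_zeroOrder (H : GridConvergence vg ug v' u' v u)
    {c : Pt d → ℝ} (hc : BddUnifCont c) :
    Consistent vg ug (fun n v u x => c (knot n x) * v x * u x)
      (∫ z, c z * W12fn v' z * W12fn u' z) := by
  obtain ⟨hcc, C, hC⟩ := hc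
  exact H.consistent_fn_fn (q := fun n x => c (knot n x)) (fun _ _ => hC _)
    (Eventually.of_forall fun z => (hcc.continuous.tendsto z).comp (tendsto_knot_cellIdx z))

end Region

/-! ### Summation over coordinate planes and assembly -/

theorem sum_pairs_eq {ι : Type*} [Fintype ι] [LinearOrder ι] (f : ι → ι → ℝ) :
    ∑ i, ∑ j, (if i < j then f i j + f j i else 0) = ∑ i, ∑ j, if i = j then 0 else f i j := by
  have h1 : ∑ i, ∑ j, (if i < j then f j i else 0) = ∑ i, ∑ j, if j < i then f i j else 0 :=
    Finset.sum_comm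
  have h2 : ∀ i j, (if i < j then f i j + f j i else 0)
      = (if i < j then f i j else 0) + if i < j then f j i else 0 := fun i j => by
    split_ifs <;> simp
  simp only [h2, Finset.sum_add_distrib]
  rw [h1, ← Finset.sum_add_distrib]
  refine Finset.sum_congr rfl fun i _ => ?_
  rw [← Finset.sum_add_distrib]
  refine Finset.sum_congr rfl fun j _ => ?_
  rcases lt_trichotomy i j with h | h | h
  · simp [h, h.ne, h.not_gt]
  · simp [h]
  · simp [h, h.ne', h.not_gt]

/-- Each direction belongs to `d - 1` coordinate planes, which exactly compensates the division of
the diagonal coefficients. The case `d = 1` has no planes and must be excluded. -/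
theorem sum_planes_eq (hd : 2 ≤ d) (I : Fin d → Fin d → ℝ) :
    ∑ i, ∑ j, (if i < j then ((d : ℝ) - 1)⁻¹ * (I i i + I j j) + (I i j + I j i) else 0)
      = ∑ i, ∑ j, I i j := by
  have hd' : (d : ℝ) - 1 ≠ 0 := by
    have : (2 : ℝ) ≤ d := by exact_mod_cast hd
    linarith
  have h := sum_pairs_eq fun i j => ((d : ℝ) - 1)⁻¹ * I i i + I i j
  have h2 : ∀ i j, ((d : ℝ) - 1)⁻¹ * (I i i + I j j) + (I i j + I j i)
      = (((d : ℝ) - 1)⁻¹ * I i i + I i j) + (((d : ℝ) - 1)⁻¹ * I j j + I j i) :=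
    fun i j => by ring
  simp only [h2]
  rw [h]
  refine Finset.sum_congr rfl fun i _ => ?_
  have h3 : ∀ j, (if i = j then 0 else ((d : ℝ) - 1)⁻¹ * I i i + I i j)
      = (((d : ℝ) - 1)⁻¹ * I i i + I i j)
        - if i = j then ((d : ℝ) - 1)⁻¹ * I i i + I i j else 0 := fun j => by
    split_ifs <;> simp
  simp only [h3, Finset.sum_sub_distrib, Finset.sum_add_distrib, Finset.sum_ite_eq,
    Finset.mem_univ, if_true, Finset.sum_const, Finset.card_univ, Fintype.card_fin, nsmul_eq_mul]
  field_simp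
  ring

/-- Consistency of the extended schemes. -/
theorem extended_scheme_consistency (hd : 2 ≤ d) {a : Fin d → Fin d → Pt d → ℝ}
    {b : Fin d → Pt d → ℝ} {c : Pt d → ℝ} {S : Fin d → Fin d → Pt d → Stencil}
    (ha : ∀ i j, BddUnifCont (a i j)) (hb : ∀ i, BddUnifCont (b i)) (hc : BddUnifCont c)
    (hS : AdmissibleStencils S) {vg ug : ℕ → Idx d → ℝ} {v' u' : W12 d} {v u : ℕ → W12 d}
    (H : GridConvergence vg ug v' u' v u) :
    (∀ n, Summable fun k : Idx d =>
      vg n k * applyMatrix (systemMatrix a b c S n) (ug n) k) ∧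
    Tendsto (fun n => step n ^ d *
        ∑' k : Idx d, vg n k * applyMatrix (systemMatrix a b c S n) (ug n) k)
      atTop (𝓝 (ellipticForm a b c v' u')) := by
  let I : Fin d → Fin d → ℝ := fun i j => ∫ z, a i j z * W12grad v' i z * W12grad u' j z
  have hplane : ∀ i j, Consistent vg ug
      (fun n v u x => if i < j then planeTerm a n i j (S i j (knot n x)) v u x else 0)
      (if i < j then ((d : ℝ) - 1)⁻¹ * (I i i + I j j) + (I i j + I j i) else 0) := by
    intro i j
    by_cases hij : i < j
    · simp only [if_pos hij]
      exact H.consistent_planeTerm ha i j (hS i j hij).1 (hS i j hij).2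
    · simp only [if_neg hij]
      exact consistent_zero
  have hall := ((Consistent.sum Finset.univ fun i _ => Consistent.sum Finset.univ fun j _ =>
    hplane i j).add (H.consistent_upwindTerm hb)).add (H.consistent_zeroOrder hc)
  rw [sum_planes_eq hd, ← sub_eq_add_neg] at hall
  -- `formMatrix` of the assembled summands unfolds to `systemMatrix`, so the matrix representation
  -- gives both the absolute convergence and the value of the matrix series.
  have hsum := fun n => (hall.1 n (vg n) (ug n) (sqSummable_of_interpFull (H.left n))
    (sqSummable_of_interpFull (H.right n))).2.2
  refine ⟨fun n => (hsum n).summable, ?_⟩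
  refine Tendsto.congr (fun n => ?_) hall.2.2
  rw [← (hsum n).tsum_eq]
  rfl

end DivScheme

end

theorem proposition5p1 (d : ℕ) :
    -- consistency of the extended schemes
    (2 ≤ d →
      ∀ (a : Fin d → Fin d → Pt d → ℝ) (b : Fin d → Pt d → ℝ) (c : Pt d → ℝ)
        (S : Fin d → Fin d → Pt d → Stencil),
        (∀ i j, BddUnifCont (a i j)) → (∀ i, BddUnifCont (b i)) → BddUnifCont c →
        AdmissibleStencils S →
      ∀ (v' u' : W12 d) (v u : ℕ → W12 d) (vg ug : ℕ → Idx d → ℝ),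
        (∀ n, W12fn (v n) =ᵐ[volume] interpFull n (vg n)) →
        (∀ n, W12fn (u n) =ᵐ[volume] interpFull n (ug n)) →
        WeaklyConverges v v' → Tendsto u atTop (𝓝 u') →
        (∀ n, Summable fun k : Idx d =>
          vg n k * applyMatrix (systemMatrix a b c S n) (ug n) k) ∧
        Tendsto (fun n => step n ^ d *
            ∑' k : Idx d, vg n k * applyMatrix (systemMatrix a b c S n) (ug n) k)
          atTop (𝓝 (ellipticForm a b c v' u')))
    ∧
    -- convergence of the Riemann-sum functionals on a family of subgrids
    (∀ (p : Pt d → ℝ) (ξ : ℕ → Pt d → Pt d) (ω : ℝ) (r : Fin d → ℕ) (ρ : ℕ → Idx d)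
        (i j : Fin d),
        BddUnifCont p → (∀ l, 0 < r l) →
        (∀ n, 1 ≤ n → ∀ m : Idx d,
          ‖ξ n (knot n (subIdx (ρ n) r m)) - knot n (subIdx (ρ n) r m)‖ ≤ ω / n) →
      ∀ (v' u' : W12 d) (v u : ℕ → W12 d) (vg ug : ℕ → Idx d → ℝ),
        (∀ n, W12fn (v n) =ᵐ[volume] interp n (ρ n) r (vg n)) →
        (∀ n, W12fn (u n) =ᵐ[volume] interp n (ρ n) r (ug n)) →
        WeaklyConverges v v' → Tendsto u atTop (𝓝 u') →
        (∀ n, Summable fun m : Idx d =>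
          riemannTerm p ξ r i j n (vg n) (ug n) (subIdx (ρ n) r m)) ∧
        Tendsto (fun n => step n ^ d * (∏ l, (r l : ℝ)) *
            ∑' m : Idx d, riemannTerm p ξ r i j n (vg n) (ug n) (subIdx (ρ n) r m))
          atTop (𝓝 (∫ x, p x * W12grad v' i x * W12grad u' j x))) := by
  refine ⟨fun hd a b c S ha hb hc hS v' u' v u vg ug hv hu hvv' huu' =>
    extended_scheme_consistency hd ha hb hc hS ⟨hv, hu, hvv', huu'⟩, ?_⟩
  intro p ξ ω r ρ i j hp hr hξ v' u' v u vg ug hv hu hvv' huu'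
  exact riemann_sum_consistency p ξ ω r ρ i j hp hr hξ v' u' v u vg ug hv hu hvv' huu'
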